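/- Let $\mathbb X$ be a locally compact separable metric space and $\mathbf m$ a positive Radon measure on $\mathbb X$ with full support; put $H=L^2(\mathbb X;\mathbf m)$. For $t\in\mathbb R$ let $(E^{(t)},F)$ be regular, local, $\mathbf m$-symmetric Dirichlet forms on $H$ with a common domain $F$, such that $t\mapsto E^{(t)}(u,u)$ is measurable for every $u\in F$ and, for some $\lambda>0$, $\lambda^{-1}\|u\|_F^2\le E^{(t)}_1(u,u)\le\lambda\|u\|_F^2$ for all $t$ and $u$, where $E^{(t)}_\alpha(u,v)=E^{(t)}(u,v)+\alpha(u,v)_{\mathbf m}$ and $\|u\|_F^2=E^{(0)}_1(u,u)$. Identify $F\subset H=H'\subset F'$ and let $\mathscr H=L^2(\mathbb R;H)$, $\mathscr F=L^2(\mathbb R;F)$, $\mathscr F'=L^2(\mathbb R;F')$. Let $\mathscr W$ be the space of all $\varphi\in\mathscr F$ whose distribution derivative (in $F'$) satisfies $\partial\varphi/\partial t\in\mathscr F'$, with $\|\varphi\|_{\mathscr W}^2=\|\partial\varphi/\partial t\|_{\mathscr F'}^2+\|\varphi\|_{\mathscr F}^2$. For $\varphi\in\mathscr W$, $\psi\in\mathscr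 F$ put $$\mathcal E_\alpha(\varphi,\psi)=-\int_{\mathbb R}\Big(\frac{\partial\varphi}{\partial t},\psi\Big)dt+\int_{\mathbb R}E^{(t)}(\varphi(t),\psi(t))\,dt+\alpha(\varphi,\psi)_{\mathscr H}.$$ For $\beta>0$ and $f\in\mathscr H$ let $G_\beta f\in\mathscr W$ be the solution of $\mathcal E_\beta(G_\beta f,\psi)=(f,\psi)_{\mathscr H}$ for all $\psi\in\mathscr F$; a function $\varphi\in\mathscr F$ is $\alpha$-excessive if $\varphi\ge0$ and $nG_{n+\alpha}\varphi\le\varphi$ a.e. for all integers $n\ge 0$. Fix $\alpha>0$ and $K\in\mathbb R$. There are constants $K_4,K_5\ge0$, depending only on the family of forms, on $\alpha$ and on $K$, with the following property. Let $g\in\mathscr W$ and let $\varphi\in\mathscr W$ be $\alpha$-excessive with $|g|\le\varphi$ a.e. with respect to $dt\,d\mathbf m$. For $\varepsilon>0$ consider the penalized problem of finding $u\in\mathscr W$ such that, for a.e. $t$, $$-\Big(\frac{\partial u}{\partial t}(t),v\Big)+E^{(t)}_\alpha(u(t),v)=\frac1\varepsilon\big((u(t)-g(t))^-,v\big)_{\mathbf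 m}\qquad\text{for all }v\in F,$$ and assume that every solution $u$ of it, for every $\varepsilon>0$, satisfies $\frac1\varepsilon\|(u-g)^-\|_{\mathscr H}\le K\|g\|_{\mathscr H}$. Then for every $\varepsilon>0$ the problem has exactly one solution $g_\varepsilon^\alpha\in\mathscr W$; $$\|g_\varepsilon^\alpha\|_{\mathscr W}\le K_4\|\varphi\|_{\mathscr W}+K_5\|g\|_{\mathscr H}\qquad\text{for all }\varepsilon>0;$$ as $\varepsilon\downarrow0$ the functions $g^\alpha_\varepsilon$ converge strongly in $\mathscr H$ to a limit $e_g$; and $$e_g\in\mathscr W,\qquad \|e_g\|_{\mathscr W}\le K_4\|\varphi\|_{\mathscr W}+K_5\|g\|_{\mathscr H}.$$ -/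

import Mathlib

open MeasureTheory Filter Topology
open scoped ContDiff InnerProductSpace

noncomputable section

/-- A symmetric Dirichlet form `(E, F)` on `L²(X; m)`: `F` is a dense subspace, `E` is a symmetric
nonnegative bilinear form on `F`, closed (i.e. `F` is complete for `E₁ = E + (·,·)_m`), and the unit
contraction operates on it. -/
structure IsDirichletForm {X : Type*} [MeasurableSpace X] {m : Measure X}
    (F : Submodule ℝ (Lp ℝ 2 m)) (E : F →ₗ[ℝ] F →ₗ[ℝ] ℝ) : Prop where
  dense : Dense (F : Set (Lp ℝ 2 m))
  symm : ∀ u v : F, E u v = E v u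
  nonneg : ∀ u : F, 0 ≤ E u u
  closed : ∀ u : ℕ → F,
    (∀ δ > 0, ∃ N, ∀ i ≥ N, ∀ j ≥ N,
      E (u i - u j) (u i - u j) + ‖(u i : Lp ℝ 2 m) - u j‖ ^ 2 < δ) →
    ∃ v : F, Tendsto (fun i => E (u i - v) (u i - v) + ‖(u i : Lp ℝ 2 m) - v‖ ^ 2) atTop (𝓝 0)
  markov : ∀ u : F, ∃ v : F,
    ((v : Lp ℝ 2 m) =ᵐ[m] fun x => min (max ((u : Lp ℝ 2 m) x) 0) 1) ∧ E v v ≤ E u u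

/-- Regularity: `F ∩ C_c(X)` is dense in `F` for `E₁`, and dense in `C_c(X)` for the uniform norm. -/
structure IsRegularForm {X : Type*} [TopologicalSpace X] [MeasurableSpace X] {m : Measure X}
    (F : Submodule ℝ (Lp ℝ 2 m)) (E : F →ₗ[ℝ] F →ₗ[ℝ] ℝ) : Prop where
  dense_form : ∀ u : F, ∀ δ > 0, ∃ (v : F) (f : X → ℝ),
    Continuous f ∧ HasCompactSupport f ∧ (v : Lp ℝ 2 m) =ᵐ[m] f ∧
      E (u - v) (u - v) + ‖(u : Lp ℝ 2 m) - v‖ ^ 2 < δ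
  dense_unif : ∀ h : X → ℝ, Continuous h → HasCompactSupport h → ∀ δ > 0, ∃ (v : F) (f : X → ℝ),
    Continuous f ∧ HasCompactSupport f ∧ (v : Lp ℝ 2 m) =ᵐ[m] f ∧ ∀ x, |h x - f x| < δ

/-- Locality: `E(u, v) = 0` whenever `u, v ∈ F` have disjoint compact supports (a function class is
supported in a compact `A` when it vanishes a.e. off `A`). -/
def IsLocalForm {X : Type*} [TopologicalSpace X] [MeasurableSpace X] {m : Measure X}
    (F : Submodule ℝ (Lp ℝ 2 m)) (E : F →ₗ[ℝ] F →ₗ[ℝ] ℝ) : Prop :=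
  ∀ (u v : F) (A B : Set X), IsCompact A → IsCompact B → Disjoint A B →
    (∀ᵐ x ∂m, x ∉ A → (u : Lp ℝ 2 m) x = 0) → (∀ᵐ x ∂m, x ∉ B → (v : Lp ℝ 2 m) x = 0) → E u v = 0

/-- A family `(E^{(t)}, F)`, `t ∈ ℝ`, of regular local symmetric Dirichlet forms on `H = L²(X; m)`
with a common domain `F`, measurable in `t` and uniformly comparable to `E₁^{(0)}`. -/
structure TimeDirichletForm {X : Type*} [TopologicalSpace X] [MeasurableSpace X]
    (m : Measure X) where
  dom : Submodule ℝ (Lp ℝ 2 m)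
  form : ℝ → dom →ₗ[ℝ] dom →ₗ[ℝ] ℝ
  isDirichlet : ∀ t, IsDirichletForm dom (form t)
  isRegular : ∀ t, IsRegularForm dom (form t)
  isLocal : ∀ t, IsLocalForm dom (form t)
  measurable_form : ∀ u : dom, Measurable fun t => form t u u
  comparable : ∃ lam : ℝ, 0 < lam ∧ ∀ (t : ℝ) (u : dom),
    lam⁻¹ * (form 0 u u + ‖(u : Lp ℝ 2 m)‖ ^ 2) ≤ form t u u + ‖(u : Lp ℝ 2 m)‖ ^ 2 ∧
    form t u u + ‖(u : Lp ℝ 2 m)‖ ^ 2 ≤ lam * (form 0 u u + ‖(u : Lp ℝ 2 m)‖ ^ 2)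

namespace TimeDirichletForm

variable {X : Type*} [TopologicalSpace X] [MeasurableSpace X] {m : Measure X}
  (D : TimeDirichletForm m)

/-- The inner product `E₁^{(0)}` on the common domain. -/
@[reducible]
def core : InnerProductSpace.Core ℝ D.dom where
  inner u v := D.form 0 u v + ⟪(u : Lp ℝ 2 m), (v : Lp ℝ 2 m)⟫_ℝ
  conj_inner_symm u v := by
    have h : D.form 0 v u = D.form 0 u v := (D.isDirichlet 0).symm v u
    simp only [h, real_inner_comm (u : Lp ℝ 2 m) (v : Lp ℝ 2 m), conj_trivial]
  re_inner_nonneg u := add_nonneg ((D.isDirichlet 0).nonneg u) real_inner_self_nonneg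
  add_left u v w := by
    simp only [map_add, LinearMap.add_apply, Submodule.coe_add, inner_add_left]; ring
  smul_left u v r := by
    simp only [map_smul, LinearMap.smul_apply, Submodule.coe_smul, inner_smul_left,
      smul_eq_mul, conj_trivial]; ring
  definite u hu := by
    have h := (D.isDirichlet 0).nonneg u
    have h2 : 0 ≤ ⟪(u : Lp ℝ 2 m), (u : Lp ℝ 2 m)⟫_ℝ := real_inner_self_nonneg
    have h3 : ⟪(u : Lp ℝ 2 m), (u : Lp ℝ 2 m)⟫_ℝ = 0 := by linarith
    exact Subtype.ext (inner_self_eq_zero.mp h3)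

/-- The common domain as a type of its own, to carry the norm `‖u‖_F² = E₁^{(0)}(u, u)`. -/
def F : Type _ := D.dom

instance : NormedAddCommGroup D.F :=
  @InnerProductSpace.Core.toNormedAddCommGroup ℝ D.dom _ _ _ D.core

instance : InnerProductSpace ℝ D.F :=
  @InnerProductSpace.ofCore ℝ D.dom _ _ _ D.core.toCore

/-- The inclusion `F ⊆ H = L²(X; m)`. -/
def inclₗ : D.F →ₗ[ℝ] Lp ℝ 2 m where
  toFun := fun u : D.dom => (u : Lp ℝ 2 m)
  map_add' _ _ := rfl
  map_smul' _ _ := rfl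

/-- `E^{(t)}` on `F`. -/
def E (t : ℝ) : D.F →ₗ[ℝ] D.F →ₗ[ℝ] ℝ :=
  LinearMap.mk₂ ℝ (fun u v : D.dom => D.form t u v)
    (fun u v w => LinearMap.map_add₂ (D.form t) u v w)
    (fun c u v => LinearMap.map_smul₂ (D.form t) c u v)
    (fun u v w => map_add (D.form t u) v w)
    (fun c u v => map_smul (D.form t u) c v)

theorem norm_sq_F (u : D.F) : ‖u‖ ^ 2 = D.E 0 u u + ‖D.inclₗ u‖ ^ 2 := by
  rw [← real_inner_self_eq_norm_sq u, ← real_inner_self_eq_norm_sq (D.inclₗ u)]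
  rfl

/-- The continuous inclusion `F ⊆ H`. -/
def incl : D.F →L[ℝ] Lp ℝ 2 m :=
  D.inclₗ.mkContinuous 1 fun u => by
    have h : 0 ≤ D.E 0 u u := (D.isDirichlet 0).nonneg u
    have h2 := D.norm_sq_F u
    rw [one_mul]
    exact abs_le_of_sq_le_sq' (by linarith) (norm_nonneg u) |>.2

/-- The inclusion `F ⊆ H = H' ⊆ F'`, `u ↦ (u, ·)_m`. -/
def toDual (u : D.F) : StrongDual ℝ D.F := (innerSL ℝ (D.incl u)).comp D.incl

/-- `𝓗 = L²(ℝ; H)`; its order is the order `ν`-a.e., `dν = dt dm`. -/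
abbrev calH (_ : TimeDirichletForm m) : Type _ := Lp (Lp ℝ 2 m) 2 (volume : Measure ℝ)

/-- `𝓕 = L²(ℝ; F)`. -/
abbrev calF : Type _ := Lp D.F 2 (volume : Measure ℝ)

/-- `𝓕' = L²(ℝ; F')`. -/
abbrev calF' : Type _ := Lp (StrongDual ℝ D.F) 2 (volume : Measure ℝ)

/-- The inclusion `𝓕 ⊆ 𝓗`. -/
def toH : D.calF →L[ℝ] D.calH := D.incl.compLpL 2 volume

/-- `ψ ∈ 𝓕'` is the distribution derivative `∂φ/∂t` of `φ ∈ 𝓕`, as an identity in `F'`. -/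
def IsTimeDeriv (φ : D.calF) (ψ : D.calF') : Prop :=
  ∀ ξ : ℝ → ℝ, ContDiff ℝ ∞ ξ → HasCompactSupport ξ →
    ∫ t, ξ t • ψ t = -∫ t, deriv ξ t • D.toDual (φ t)

/-- `φ ∈ 𝓦`. -/
def MemW (φ : D.calF) : Prop := ∃ ψ : D.calF', D.IsTimeDeriv φ ψ

open Classical in
/-- `∂φ/∂t` for `φ ∈ 𝓦` (and `0` otherwise). -/
def timeDeriv (φ : D.calF) : D.calF' := if h : D.MemW φ then h.choose else 0

theorem IsTimeDeriv.unique {D : TimeDirichletForm m} {φ : D.calF} {ψ₁ ψ₂ : D.calF'}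
    (h₁ : D.IsTimeDeriv φ ψ₁) (h₂ : D.IsTimeDeriv φ ψ₂) : ψ₁ = ψ₂ := by
  have li : ∀ ψ : D.calF', LocallyIntegrable ψ volume := fun ψ =>
    (Lp.memLp ψ).locallyIntegrable (by norm_num)
  have key := ae_eq_of_integral_contDiff_smul_eq (li ψ₁) (li ψ₂)
    fun ξ hξ hc => (h₁ ξ hξ hc).trans (h₂ ξ hξ hc).symm
  exact Lp.ext key

theorem IsTimeDeriv.timeDeriv_eq {D : TimeDirichletForm m} {φ : D.calF} {ψ : D.calF'}
    (h : D.IsTimeDeriv φ ψ) : D.timeDeriv φ = ψ := by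
  have hm : D.MemW φ := ⟨ψ, h⟩
  rw [timeDeriv, dif_pos hm]
  exact hm.choose_spec.unique h

/-- `‖φ‖_𝓦`, for `φ ∈ 𝓦`. -/
def normW (φ : D.calF) : ℝ := √(‖D.timeDeriv φ‖ ^ 2 + ‖φ‖ ^ 2)

/-- `𝓔_α(φ, ψ) = -⟨∂φ/∂t, ψ⟩ + ∫ E^{(t)}(φ(t), ψ(t)) dt + α (φ, ψ)_𝓗`, for `φ ∈ 𝓦`, `ψ ∈ 𝓕`. -/
def calE (α : ℝ) (φ ψ : D.calF) : ℝ :=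
  -(∫ t, D.timeDeriv φ t (ψ t)) + (∫ t, D.E t (φ t) (ψ t)) + α * ⟪D.toH φ, D.toH ψ⟫_ℝ

/-- `u = G_β f`, i.e. `u ∈ 𝓦` and `𝓔_β(u, ψ) = (f, ψ)_𝓗` for all `ψ ∈ 𝓕`. -/
def IsResolvent (β : ℝ) (f : D.calH) (u : D.calF) : Prop :=
  D.MemW u ∧ ∀ ψ : D.calF, D.calE β u ψ = ⟪f, D.toH ψ⟫_ℝ

/-- `φ` is `α`-excessive: `φ ≥ 0` and `n G_{n+α} φ ≤ φ` a.e. for all `n ≥ 0`. -/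
def IsExcessive (α : ℝ) (φ : D.calF) : Prop :=
  0 ≤ D.toH φ ∧ ∀ (n : ℕ) (u : D.calF), D.IsResolvent (n + α) (D.toH φ) u →
    (n : ℝ) • D.toH u ≤ D.toH φ

/-- `u ∈ 𝓦` solves the penalized problem: for a.e. `t` and all `v ∈ F`,
`-(∂u/∂t, v) + E_α^{(t)}(u(t), v) = ε⁻¹ ((u(t) - g(t))⁻, v)_m`. -/
def IsPenalizedSolution (α ε : ℝ) (g u : D.calF) : Prop :=
  D.MemW u ∧ ∀ᵐ t : ℝ, ∀ v : D.F,
    -(D.timeDeriv u t v) + (D.E t (u t) v + α * ⟪D.incl (u t), D.incl v⟫_ℝ) =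
      1 / ε * ⟪(D.incl (u t) - D.incl (g t))⁻, D.incl v⟫_ℝ

end TimeDirichletForm

end

/-! Once the penalty `f = ε⁻¹(u - g)⁻` is regarded as given data, the penalized problem is the
linear backward parabolic equation `-∂u/∂t + A u + α u = f`, whose solution satisfies `‖u‖_𝓦 ≤ C
‖f‖_𝓗` with `C = bddConst α`. The assumed bound on penalties therefore gives the 𝓦 bound at once,
with `K₄ = 0` and `K₅ = C |K|`.

The linear theory rests on `∫ (∂u/∂t, u) dt = 0` for `u ∈ 𝓦` (`inner_weakDeriv_self_eq_zero`), which
gives the energy identity and hence uniqueness and the estimates. Existence is Lions' projection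
theorem (`exists_inner_eq_of_coercive`), after which the equation itself places the derivative in
`𝓕'` (`IsWeakSolution.solvesLinear`). Adding `u/ε` to both sides turns the penalty into `ε⁻¹(u ∨
g)`, and a contraction in 𝓗 solves the nonlinear problem.

For two parameters, the complementarity of positive and negative parts gives `coer α * ‖u_ε - u_δ‖²
≤ (ε + δ) R²` in 𝓕 (`inner_penalty_sub_le`). So the solutions converge strongly in 𝓕. The penalties
converge weakly along a subsequence, and the limit solves the linear equation with a source of norm
at most `R`, so it inherits the same bound. -/

noncomputable section

/-! ### Integration by parts for weak time derivatives -/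

section IntegrationByParts

variable {V W : Type*} [NormedAddCommGroup V] [InnerProductSpace ℝ V]
  [NormedAddCommGroup W] [InnerProductSpace ℝ W]

/-- The integrand is dominated by `|k(s - t)| (‖f s‖² + ‖g t‖²)`, and each summand is the
convolution integrand of two integrable functions. -/
theorem integrable_convolution_inner (k : ℝ → ℝ) (hk : Continuous k) (hkc : HasCompactSupport k)
    (f g : Lp V 2 (volume : Measure ℝ)) :
    Integrable (fun p : ℝ × ℝ => k (p.2 - p.1) * ⟪f p.2, g p.1⟫_ℝ) (volume.prod volume) := by
  have hki : Integrable k volume := hk.integrable_of_hasCompactSupport hkc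
  have hf : Integrable (fun t => ‖f t‖ ^ 2) volume := (Lp.memLp f).integrable_norm_pow (by norm_num)
  have hg : Integrable (fun t => ‖g t‖ ^ 2) volume := (Lp.memLp g).integrable_norm_pow (by norm_num)
  have h1 : Integrable (fun p : ℝ × ℝ => ‖f p.2‖ ^ 2 * |k (-(p.1 - p.2))|) (volume.prod volume) :=
    hf.convolution_integrand (ContinuousLinearMap.mul ℝ ℝ) (g := fun s => |k (-s)|)
      (hki.comp_neg.norm)
  have h2 : Integrable (fun p : ℝ × ℝ => ‖g p.1‖ ^ 2 * |k (p.2 - p.1)|) (volume.prod volume) :=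
    (hg.convolution_integrand (ContinuousLinearMap.mul ℝ ℝ) (g := fun s => |k s|) hki.norm).swap
  refine (h1.add h2).mono' ?_ (Eventually.of_forall fun p => ?_)
  · refine AEStronglyMeasurable.mul (by fun_prop) ?_
    exact AEStronglyMeasurable.inner (Lp.aestronglyMeasurable f).comp_snd
      (Lp.aestronglyMeasurable g).comp_fst
  · have h3 := abs_real_inner_le_norm (f p.2) (g p.1)
    have h4 : |⟪f p.2, g p.1⟫_ℝ| ≤ ‖f p.2‖ ^ 2 + ‖g p.1‖ ^ 2 := by
      nlinarith [sq_nonneg (‖f p.2‖ - ‖g p.1‖), sq_nonneg ‖f p.2‖, sq_nonneg ‖g p.1‖]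
    simp only [Pi.add_apply, neg_sub, Real.norm_eq_abs, abs_mul]
    nlinarith [abs_nonneg (k (p.2 - p.1))]

/-- Exchanging `s` and `t` changes the sign of the integrand, and Fubini allows the exchange. -/
theorem integral_integral_odd_inner_eq_zero (k : ℝ → ℝ) (hk : Continuous k)
    (hkc : HasCompactSupport k) (hodd : ∀ x, k (-x) = -k x) (f : Lp V 2 (volume : Measure ℝ)) :
    ∫ t, ∫ s, k (s - t) * ⟪f s, f t⟫_ℝ = 0 := by
  have h := integral_integral_swap (f := fun t s => k (s - t) * ⟪f s, f t⟫_ℝ)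
    (integrable_convolution_inner k hk hkc f f)
  have h2 : ∀ s t : ℝ, k (s - t) * ⟪f s, f t⟫_ℝ = -(k (t - s) * ⟪f t, f s⟫_ℝ) := fun s t => by
    rw [← neg_sub t s, hodd, real_inner_comm]; ring
  have h3 : ∫ s, ∫ t, k (s - t) * ⟪f s, f t⟫_ℝ = -∫ s, ∫ t, k (t - s) * ⟪f t, f s⟫_ℝ := by
    rw [← integral_neg]
    refine integral_congr_ae (Eventually.of_forall fun s => ?_)
    simp only
    rw [← integral_neg]
    exact integral_congr_ae (Eventually.of_forall fun t => h2 s t)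
  linarith

theorem integral_translate_inner (ρ : ℝ → ℝ) (hρ : Continuous ρ) (hρc : HasCompactSupport ρ)
    (q w : Lp V 2 (volume : Measure ℝ)) :
    ∫ h, ρ h * ∫ t, ⟪q (t + h), w t⟫_ℝ = ∫ t, ∫ s, ρ (s - t) * ⟪q s, w t⟫_ℝ := by
  have hi : Integrable (fun p : ℝ × ℝ => ρ p.2 * ⟪q (p.1 + p.2), w p.1⟫_ℝ)
      (volume.prod volume) := by
    have := (measurePreserving_prod_add (volume : Measure ℝ)
      (volume : Measure ℝ)).integrable_comp_of_integrable (integrable_convolution_inner ρ hρ hρc q w)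
    simpa [Function.comp_def] using this
  have h := integral_integral_swap (f := fun t h => ρ h * ⟪q (t + h), w t⟫_ℝ) hi
  simp only [← integral_const_mul]
  rw [← h]
  refine integral_congr_ae (Eventually.of_forall fun t => ?_)
  simp only
  rw [← integral_add_left_eq_self (fun s => ρ (s - t) * ⟪q s, w t⟫_ℝ) t]
  simp

theorem continuous_translate_inner (q w : Lp V 2 (volume : Measure ℝ)) :
    Continuous fun h : ℝ => ∫ t, ⟪q (t + h), w t⟫_ℝ := by
  have h : ∀ h : ℝ, ∫ t, ⟪q (t + h), w t⟫_ℝ = ⟪(DomAddAct.mk h) +ᵥ q, w⟫_ℝ := fun h => by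
    rw [L2.inner_def]
    refine integral_congr_ae ?_
    filter_upwards [DomAddAct.vadd_Lp_ae_eq (DomAddAct.mk h) q] with t ht
    rw [ht]
    simp [add_comm]
  simp_rw [h]
  have : Fact ((2 : ENNReal) ≠ ⊤) := ⟨by norm_num⟩
  have : Continuous fun h : ℝ => (DomAddAct.mk h) +ᵥ q :=
    (DomAddAct.continuous_mk).vadd continuous_const
  fun_prop

/-- If `q` is the derivative of `w` with respect to the pivot inner product pulled back along `ι`,
then `∫ ⟨q, w⟩ = 0`. -/
theorem inner_weakDeriv_self_eq_zero (ι : V →L[ℝ] W) (q w : Lp V 2 (volume : Measure ℝ))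
    (hq : ∀ (ξ : ℝ → ℝ) (v : V), ContDiff ℝ ∞ ξ → HasCompactSupport ξ →
      ∫ t, ξ t * ⟪q t, v⟫_ℝ = -∫ t, deriv ξ t * ⟪ι (w t), ι v⟫_ℝ) :
    ⟪q, w⟫_ℝ = 0 := by
  -- The correlation `h ↦ ∫ ⟨q(t + h), w(t)⟩ dt` integrates to zero against every even bump: moving
  -- the derivative onto the bump leaves an odd kernel.
  have key : ∀ ρ : ContDiffBump (0 : ℝ), ∫ h, ρ.normed volume h * ∫ t, ⟪q (t + h), w t⟫_ℝ = 0 := by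
    intro ρ
    set r := ρ.normed (volume : Measure ℝ)
    have hrs : ContDiff ℝ ∞ r := ρ.contDiff_normed
    have hrc : HasCompactSupport r := ρ.hasCompactSupport_normed
    have heven : ∀ x, r (-x) = r x := fun x => ρ.normed_neg x
    have hodd : ∀ x, deriv r (-x) = -deriv r x := fun x => by
      have h1 : (fun x => r (-x)) = r := funext heven
      have h2 := deriv_comp_neg r x
      rw [h1] at h2
      linarith
    rw [integral_translate_inner r hrs.continuous hrc]
    have h5 : ∀ᵐ t, ∫ s, r (s - t) * ⟪q s, w t⟫_ℝ =
        -∫ s, deriv r (s - t) * ⟪ι.compLpL 2 volume w s, ι.compLpL 2 volume w t⟫_ℝ := by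
      filter_upwards [ι.coeFn_compLpL (p := 2) (μ := volume) w] with t ht
      -- The time `t` is frozen: the test function is the bump translated to `t`, and the test
      -- vector is `w t`.
      have h4 := hq (fun s => r (s - t)) (w t) (hrs.comp (contDiff_id.sub contDiff_const))
        (hrc.comp_homeomorph (Homeomorph.subRight t))
      simp only [deriv_comp_sub_const] at h4
      rw [h4, neg_inj]
      refine integral_congr_ae ?_
      filter_upwards [ι.coeFn_compLpL (p := 2) (μ := volume) w] with s hs
      rw [hs, ht]
    rw [integral_congr_ae h5, integral_neg, integral_integral_odd_inner_eq_zero (deriv r)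
      (hrs.continuous_deriv (by simp)) hrc.deriv hodd, neg_zero]
  let φ : ℕ → ContDiffBump (0 : ℝ) := fun n =>
    { rIn := 1 / (n + 1), rOut := 2 * (1 / (n + 1)), rIn_pos := by positivity
      rIn_lt_rOut := by have : (0 : ℝ) < 1 / (n + 1) := by positivity
                        linarith }
  have hφ : Tendsto (fun n => (φ n).rOut) atTop (𝓝 0) := by
    have := (tendsto_one_div_add_atTop_nhds_zero_nat (𝕜 := ℝ)).const_mul 2
    simpa [φ] using this
  -- Shrinking bumps recover the value of the correlation at `h = 0`; the reflection cancels the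
  -- sign in the convolution.
  have hc : Continuous fun h : ℝ => ∫ t, ⟪q (t + -h), w t⟫_ℝ :=
    (continuous_translate_inner q w).comp continuous_neg
  have hlim := ContDiffBump.convolution_tendsto_right_of_continuous (μ := volume) hφ hc 0
  simp only [MeasureTheory.convolution, ContinuousLinearMap.lsmul_apply, zero_sub, neg_neg,
    smul_eq_mul, key, neg_zero, add_zero] at hlim
  rw [L2.inner_def]
  exact tendsto_nhds_unique hlim tendsto_const_nhds |>.symm ▸ rfl

end IntegrationByParts

/-! ### The Hilbert space `F` and the time-integrated form -/

namespace TimeDirichletForm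

variable {X : Type*} [TopologicalSpace X] [MeasurableSpace X] {m : Measure X}
  (D : TimeDirichletForm m)

@[simp] theorem incl_apply (u : D.F) : D.incl u = D.inclₗ u := rfl

theorem incl_injective : Function.Injective D.incl := fun _ _ h => Subtype.ext h

theorem norm_incl_le (u : D.F) : ‖D.incl u‖ ≤ ‖u‖ := by
  have h : 0 ≤ D.E 0 u u := (D.isDirichlet 0).nonneg u
  have h2 := D.norm_sq_F u
  exact abs_le_of_sq_le_sq' (by rw [incl_apply]; linarith) (norm_nonneg u) |>.2

instance : CompleteSpace D.F := by
  refine Metric.complete_of_cauchySeq_tendsto fun u hu => ?_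
  obtain ⟨v, hv⟩ : ∃ v : D.F, Tendsto (fun i => D.E 0 (u i - v) (u i - v) +
      ‖D.inclₗ (u i - v)‖ ^ 2) atTop (𝓝 0) := (D.isDirichlet 0).closed u fun δ hδ => by
    obtain ⟨N, hN⟩ := Metric.cauchySeq_iff.mp hu (√δ) (Real.sqrt_pos.mpr hδ)
    refine ⟨N, fun i hi j hj => ?_⟩
    have h1 := hN i hi j hj
    rw [dist_eq_norm] at h1
    have h2 := D.norm_sq_F (u i - u j)
    have h3 : ‖u i - u j‖ ^ 2 < δ := by
      calc ‖u i - u j‖ ^ 2 < √δ ^ 2 := by gcongr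
        _ = δ := Real.sq_sqrt hδ.le
    rw [h2] at h3
    exact h3
  refine ⟨v, ?_⟩
  rw [tendsto_iff_norm_sub_tendsto_zero]
  have h4 : Tendsto (fun i => √(‖u i - v‖ ^ 2)) atTop (𝓝 0) := by
    rw [← Real.sqrt_zero]
    refine (Real.continuous_sqrt.tendsto 0).comp ?_
    refine hv.congr fun i => ?_
    rw [D.norm_sq_F (u i - v)]
  exact h4.congr fun i => Real.sqrt_sq (norm_nonneg _)

/-- The inclusion into `H` is injective, so its adjoint maps the separable space `H` onto a dense
subspace of `F`. -/
instance [TopologicalSpace.SeparableSpace (Lp ℝ 2 m)] : TopologicalSpace.SeparableSpace D.F := by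
  have h : DenseRange (ContinuousLinearMap.adjoint D.incl) := by
    have h1 : (LinearMap.range (ContinuousLinearMap.adjoint D.incl).toLinearMap).topologicalClosure
        = ⊤ := by
      rw [Submodule.topologicalClosure_eq_top_iff, Submodule.eq_bot_iff]
      intro u hu
      apply D.incl_injective
      rw [map_zero, ← inner_self_eq_zero (𝕜 := ℝ), ← ContinuousLinearMap.adjoint_inner_left]
      exact (Submodule.mem_orthogonal _ _).mp hu _ ⟨_, rfl⟩
    exact Submodule.dense_iff_topologicalClosure_eq_top.mpr h1
  exact h.separableSpace (ContinuousLinearMap.adjoint D.incl).continuous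

/-- A constant of comparison between the forms. -/
def lam : ℝ := D.comparable.choose

theorem lam_pos : 0 < D.lam := D.comparable.choose_spec.1

theorem lower_bound (t : ℝ) (u : D.F) :
    D.lam⁻¹ * ‖u‖ ^ 2 ≤ D.E t u u + ‖D.incl u‖ ^ 2 := by
  rw [D.norm_sq_F]; exact (D.comparable.choose_spec.2 t u).1

theorem upper_bound (t : ℝ) (u : D.F) :
    D.E t u u + ‖D.incl u‖ ^ 2 ≤ D.lam * ‖u‖ ^ 2 := by
  rw [D.norm_sq_F]; exact (D.comparable.choose_spec.2 t u).2

theorem E_self_nonneg (t : ℝ) (u : D.F) : 0 ≤ D.E t u u := (D.isDirichlet t).nonneg u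

theorem E_comm (t : ℝ) (u v : D.F) : D.E t u v = D.E t v u := (D.isDirichlet t).symm u v

theorem E_self_le (t : ℝ) (u : D.F) : D.E t u u ≤ D.lam * ‖u‖ ^ 2 := by
  have := D.upper_bound t u
  nlinarith [sq_nonneg ‖D.incl u‖]

/-- Cauchy–Schwarz through the discriminant, since `E^{(t)}` is only semidefinite. -/
theorem abs_E_le (t : ℝ) (u v : D.F) : |D.E t u v| ≤ D.lam * ‖u‖ * ‖v‖ := by
  have h : ∀ c : ℝ, 0 ≤ D.E t u u * (c * c) + (2 * D.E t u v) * c + D.E t v v := fun c => by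
    have := D.E_self_nonneg t (c • u + v)
    simp only [map_add, map_smul, LinearMap.add_apply, LinearMap.smul_apply, smul_eq_mul,
      D.E_comm t v u] at this
    linarith
  have h2 := discrim_le_zero h
  rw [discrim] at h2
  have h3 : D.E t u v ^ 2 ≤ (D.lam * ‖u‖ * ‖v‖) ^ 2 := by
    calc D.E t u v ^ 2 ≤ D.E t u u * D.E t v v := by linarith
      _ ≤ (D.lam * ‖u‖ ^ 2) * (D.lam * ‖v‖ ^ 2) :=
        mul_le_mul (D.E_self_le t u) (D.E_self_le t v) (D.E_self_nonneg t v)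
          (mul_nonneg D.lam_pos.le (sq_nonneg _))
      _ = _ := by ring
  exact abs_le_of_sq_le_sq h3 (mul_nonneg (mul_nonneg D.lam_pos.le (norm_nonneg _)) (norm_nonneg _))

theorem measurable_E (u v : D.F) : Measurable fun t => D.E t u v := by
  have h : (fun t => D.E t u v) = fun t => (D.E t (u + v) (u + v) - D.E t u u - D.E t v v) / 2 := by
    funext t
    simp only [map_add, LinearMap.add_apply, D.E_comm t v u]
    ring
  rw [h]
  exact (((D.measurable_form (u + v)).sub (D.measurable_form u)).sub (D.measurable_form v)).div_const 2

/-- `E^{(t)}` as a continuous bilinear form. -/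
def Ec (t : ℝ) : D.F →L[ℝ] D.F →L[ℝ] ℝ :=
  (D.E t).mkContinuous₂ D.lam (D.abs_E_le t)

theorem toH_apply (u : D.calF) : ∀ᵐ t, D.toH u t = D.incl (u t) := D.incl.coeFn_compLpL u

theorem norm_sq_eq_integral (u : D.calF) : ‖u‖ ^ 2 = ∫ t, ‖u t‖ ^ 2 := by
  rw [← real_inner_self_eq_norm_sq, L2.inner_def]
  simp only [real_inner_self_eq_norm_sq]

/-- The coercivity constant of `E_β`. -/
def coer (β : ℝ) : ℝ := min 1 β * D.lam⁻¹

theorem coer_pos {β : ℝ} (hβ : 0 < β) : 0 < D.coer β :=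
  mul_pos (lt_min one_pos hβ) (inv_pos.mpr D.lam_pos)

theorem abs_integral_E_le (u v : D.calF) :
    |∫ t, D.E t (u t) (v t)| ≤ D.lam * ‖u‖ * ‖v‖ := by
  have hi : Integrable (fun t => D.lam * (‖u t‖ * ‖v t‖)) volume :=
    ((Lp.memLp u).norm.integrable_mul (Lp.memLp v).norm).const_mul _
  have h1 : ‖∫ t, D.E t (u t) (v t)‖ ≤ ∫ t, D.lam * (‖u t‖ * ‖v t‖) :=
    norm_integral_le_of_norm_le hi (Eventually.of_forall fun t => by
      rw [← mul_assoc]; exact D.abs_E_le t _ _)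
  have h2 := real_inner_le_norm ((Lp.memLp u).norm.toLp _) ((Lp.memLp v).norm.toLp _)
  rw [L2.inner_def, Lp.norm_toLp, Lp.norm_toLp, eLpNorm_norm, eLpNorm_norm, ← Lp.norm_def,
    ← Lp.norm_def] at h2
  have h3 : ∫ t, ⟪(Lp.memLp u).norm.toLp _ t, (Lp.memLp v).norm.toLp _ t⟫_ℝ =
      ∫ t, ‖u t‖ * ‖v t‖ := by
    refine integral_congr_ae ?_
    filter_upwards [(Lp.memLp u).norm.coeFn_toLp, (Lp.memLp v).norm.coeFn_toLp] with t h h'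
    rw [h, h', RCLike.inner_apply, conj_trivial, mul_comm]
  rw [h3] at h2
  rw [integral_const_mul] at h1
  calc _ ≤ _ := h1
    _ ≤ D.lam * (‖u‖ * ‖v‖) := mul_le_mul_of_nonneg_left h2 D.lam_pos.le
    _ = _ := by ring

variable [TopologicalSpace.SeparableSpace (Lp ℝ 2 m)]

/-- `E^{(t)}(x, y)` is a Carathéodory function: continuous in `(x, y)`, measurable in `t` by
polarization. Separability of `F` makes it jointly measurable. -/
theorem aestronglyMeasurable_E {u v : ℝ → D.F} (hu : AEStronglyMeasurable u volume)
    (hv : AEStronglyMeasurable v volume) :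
    AEStronglyMeasurable (fun t => D.E t (u t) (v t)) volume := by
  borelize D.F
  have : SecondCountableTopology D.F := UniformSpace.secondCountable_of_separable _
  have h : StronglyMeasurable (Function.uncurry fun (p : D.F × D.F) (t : ℝ) => D.E t p.1 p.2) :=
    stronglyMeasurable_uncurry_of_continuous_of_stronglyMeasurable
      (fun t => ((D.Ec t).continuous.comp continuous_fst).clm_apply continuous_snd)
      fun p => (D.measurable_E p.1 p.2).stronglyMeasurable
  exact (h.measurable.comp_aemeasurable
    ((hu.aemeasurable.prodMk hv.aemeasurable).prodMk aemeasurable_id)).aestronglyMeasurable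

theorem integrable_E (u v : D.calF) : Integrable (fun t => D.E t (u t) (v t)) volume := by
  have hi : Integrable (fun t => D.lam * (‖u t‖ * ‖v t‖)) volume :=
    ((Lp.memLp u).norm.integrable_mul (Lp.memLp v).norm).const_mul _
  refine hi.mono' (D.aestronglyMeasurable_E (Lp.aestronglyMeasurable u) (Lp.aestronglyMeasurable v))
    (Eventually.of_forall fun t => ?_)
  rw [← mul_assoc]; exact D.abs_E_le t _ _

/-- `∫ E^{(t)}(u(t), v(t)) dt`. -/
def intE : D.calF →L[ℝ] D.calF →L[ℝ] ℝ :=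
  LinearMap.mkContinuous₂ (LinearMap.mk₂ ℝ (fun u v : D.calF => ∫ t, D.E t (u t) (v t))
    (fun u u' v => by
      rw [← integral_add (D.integrable_E u v) (D.integrable_E u' v)]
      refine integral_congr_ae ?_
      filter_upwards [Lp.coeFn_add u u'] with t h
      rw [h, Pi.add_apply, map_add, LinearMap.add_apply])
    (fun c u v => by
      rw [smul_eq_mul, ← integral_const_mul]
      refine integral_congr_ae ?_
      filter_upwards [Lp.coeFn_smul c u] with t h
      rw [h, Pi.smul_apply, map_smul, LinearMap.smul_apply, smul_eq_mul])
    (fun u v v' => by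
      rw [← integral_add (D.integrable_E u v) (D.integrable_E u v')]
      refine integral_congr_ae ?_
      filter_upwards [Lp.coeFn_add v v'] with t h
      rw [h, Pi.add_apply, map_add])
    (fun c u v => by
      rw [smul_eq_mul, ← integral_const_mul]
      refine integral_congr_ae ?_
      filter_upwards [Lp.coeFn_smul c v] with t h
      rw [h, Pi.smul_apply, map_smul, smul_eq_mul])) D.lam D.abs_integral_E_le

theorem intE_apply (u v : D.calF) : D.intE u v = ∫ t, D.E t (u t) (v t) := rfl

theorem intE_self_nonneg (u : D.calF) : 0 ≤ D.intE u u :=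
  integral_nonneg fun t => D.E_self_nonneg t _

theorem intE_coercive (u : D.calF) : D.lam⁻¹ * ‖u‖ ^ 2 ≤ D.intE u u + ‖D.toH u‖ ^ 2 := by
  rw [norm_sq_eq_integral, intE_apply, ← real_inner_self_eq_norm_sq (D.toH u), L2.inner_def,
    ← integral_add (D.integrable_E u u) (L2.integrable_inner _ _), ← integral_const_mul]
  refine integral_mono_ae (((Lp.memLp u).integrable_norm_pow (by norm_num)).const_mul _)
    ((D.integrable_E u u).add (L2.integrable_inner _ _)) ?_
  filter_upwards [D.toH_apply u] with t ht
  rw [ht, real_inner_self_eq_norm_sq]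
  exact D.lower_bound t _

theorem coer_le (β : ℝ) (hβ : 0 < β) (u : D.calF) :
    D.coer β * ‖u‖ ^ 2 ≤ D.intE u u + β * ‖D.toH u‖ ^ 2 := by
  have h1 := D.intE_coercive u
  have h2 : 0 < min 1 β := lt_min one_pos hβ
  calc D.coer β * ‖u‖ ^ 2 = min 1 β * (D.lam⁻¹ * ‖u‖ ^ 2) := by rw [coer]; ring
    _ ≤ min 1 β * (D.intE u u + ‖D.toH u‖ ^ 2) := by gcongr
    _ = min 1 β * D.intE u u + min 1 β * ‖D.toH u‖ ^ 2 := by ring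
    _ ≤ 1 * D.intE u u + β * ‖D.toH u‖ ^ 2 := by
      have := D.intE_self_nonneg u
      gcongr
      · exact min_le_left _ _
      · exact min_le_right _ _
    _ = _ := by ring

end TimeDirichletForm

/-- Lions' projection theorem for a bilinear form given by a linear map `T` from the test space. -/
theorem exists_inner_eq_of_coercive {V P : Type*} [NormedAddCommGroup V] [InnerProductSpace ℝ V]
    [CompleteSpace V] [AddCommGroup P] [Module ℝ P] (T j : P →ₗ[ℝ] V) (c : ℝ) (hc : 0 < c)
    (hT : ∀ p, c * ‖j p‖ ^ 2 ≤ ⟪T p, j p⟫_ℝ) (L : V →L[ℝ] ℝ) :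
    ∃ u : V, ∀ p, ⟪T p, u⟫_ℝ = L (j p) := by
  have hb : ∀ p, ‖j p‖ ≤ c⁻¹ * ‖T p‖ := fun p => by
    rcases (norm_nonneg (j p)).eq_or_lt with h | h
    · rw [← h]; positivity
    · have h1 := (hT p).trans (real_inner_le_norm _ _)
      have h2 : c * ‖j p‖ ≤ ‖T p‖ := by
        rw [pow_two, ← mul_assoc] at h1
        exact le_of_mul_le_mul_right h1 h
      rw [inv_mul_eq_div, le_div_iff₀ hc]; linarith
  -- The functional `T p ↦ L (j p)` is bounded on the range of `T` by `hb`; it is written with a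
  -- linear section `s` of `T` and extended by Hahn–Banach.
  obtain ⟨s, hs⟩ := T.rangeRestrict.exists_rightInverse_of_surjective T.range_rangeRestrict
  have hs' : ∀ y, T (s y) = y := fun y =>
    congrArg Subtype.val (LinearMap.congr_fun hs y)
  let ℓ : LinearMap.range T →L[ℝ] ℝ :=
    (L.toLinearMap ∘ₗ j ∘ₗ s).mkContinuous (‖L‖ * c⁻¹) fun y => by
      calc ‖L (j (s y))‖ ≤ ‖L‖ * ‖j (s y)‖ := L.le_opNorm _
        _ ≤ ‖L‖ * (c⁻¹ * ‖T (s y)‖) := by gcongr; exact hb _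
        _ = ‖L‖ * c⁻¹ * ‖y‖ := by rw [hs', Submodule.coe_norm, mul_assoc]
  obtain ⟨g, hg, -⟩ := exists_extension_norm_eq (LinearMap.range T) ℓ
  refine ⟨(InnerProductSpace.toDual ℝ V).symm g, fun p => ?_⟩
  have h1 : j (s (T.rangeRestrict p)) = j p := by
    -- Independence of the section: `T` kills `s (T p) - p`, so by `hb` so does `j`.
    have h2 := hb (s (T.rangeRestrict p) - p)
    have h3 : T (s (T.rangeRestrict p)) = T p := hs' _
    rw [map_sub T, h3, sub_self, norm_zero, mul_zero, map_sub] at h2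
    exact sub_eq_zero.mp (norm_le_zero_iff.mp h2)
  rw [real_inner_comm, InnerProductSpace.toDual_symm_apply]
  exact (hg (T.rangeRestrict p)).trans (congrArg L h1)

/-! ### Test functions and existence of weak solutions -/

namespace TimeDirichletForm

variable {X : Type*} [TopologicalSpace X] [MeasurableSpace X] {m : Measure X}
  (D : TimeDirichletForm m)

theorem memLp_smul {ξ : ℝ → ℝ} (hξ : Continuous ξ) (hc : HasCompactSupport ξ) (v : D.F) :
    MemLp (fun t => ξ t • v) 2 (volume : Measure ℝ) :=
  (hξ.smul continuous_const).memLp_of_hasCompactSupport hc.smul_right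

/-- The test function `t ↦ ξ(t) v`. -/
def tensor {ξ : ℝ → ℝ} (hξ : Continuous ξ) (hc : HasCompactSupport ξ) (v : D.F) : D.calF :=
  (D.memLp_smul hξ hc v).toLp _

theorem tensor_apply {ξ : ℝ → ℝ} (hξ : Continuous ξ) (hc : HasCompactSupport ξ) (v : D.F) :
    ∀ᵐ t, D.tensor hξ hc v t = ξ t • v := (D.memLp_smul hξ hc v).coeFn_toLp

theorem inner_toH_tensor (f : D.calH) {ξ : ℝ → ℝ} (hξ : Continuous ξ) (hc : HasCompactSupport ξ)
    (v : D.F) : ⟪f, D.toH (D.tensor hξ hc v)⟫_ℝ = ∫ t, ξ t * ⟪f t, D.incl v⟫_ℝ := by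
  rw [L2.inner_def]
  refine integral_congr_ae ?_
  filter_upwards [D.toH_apply (D.tensor hξ hc v), D.tensor_apply hξ hc v] with t h1 h2
  rw [h1, h2, map_smul, inner_smul_right]

/-- Tensors `ξ ⊗ v` paired with their time derivatives. -/
def tensorPairs : Set (D.calF × D.calF) :=
  {p | ∃ (ξ : ℝ → ℝ) (v : D.F) (hξ : ContDiff ℝ ∞ ξ) (hc : HasCompactSupport ξ),
    p = (D.tensor hξ.continuous hc v, D.tensor (hξ.continuous_deriv (by simp)) hc.deriv v)}

/-- Test functions in the span of the `ξ ⊗ v`, paired with their time derivatives. -/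
def testPairs : Submodule ℝ (D.calF × D.calF) := Submodule.span ℝ D.tensorPairs

/-- Scalar integration by parts on tensors, extended bilinearly. On the diagonal it says that the
time derivative contributes nothing to the energy of a test function. -/
theorem inner_testPairs_antisymm {p q : D.calF × D.calF} (hp : p ∈ D.testPairs)
    (hq : q ∈ D.testPairs) :
    ⟪D.toH p.1, D.toH q.2⟫_ℝ + ⟪D.toH p.2, D.toH q.1⟫_ℝ = 0 := by
  induction hp, hq using Submodule.span_induction₂ with
  | mem_mem p q hp hq =>
    obtain ⟨ξ, v, hξ, hc, rfl⟩ := hp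
    obtain ⟨η, w, hη, hd, rfl⟩ := hq
    have hξ' : Continuous (deriv ξ) := hξ.continuous_deriv (by simp)
    have hη' : Continuous (deriv η) := hη.continuous_deriv (by simp)
    rw [inner_toH_tensor, inner_toH_tensor]
    have e1 : ∫ t, deriv η t * ⟪D.toH (D.tensor hξ.continuous hc v) t, D.incl w⟫_ℝ =
        (∫ t, ξ t * deriv η t) * ⟪D.incl v, D.incl w⟫_ℝ := by
      rw [← integral_mul_const]
      refine integral_congr_ae ?_
      filter_upwards [D.toH_apply (D.tensor hξ.continuous hc v),
        D.tensor_apply hξ.continuous hc v] with t h1 h2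
      rw [h1, h2, map_smul, inner_smul_left, conj_trivial]; ring
    have e2 : ∫ t, η t * ⟪D.toH (D.tensor hξ' hc.deriv v) t, D.incl w⟫_ℝ =
        (∫ t, deriv ξ t * η t) * ⟪D.incl v, D.incl w⟫_ℝ := by
      rw [← integral_mul_const]
      refine integral_congr_ae ?_
      filter_upwards [D.toH_apply (D.tensor hξ' hc.deriv v),
        D.tensor_apply hξ' hc.deriv v] with t h1 h2
      rw [h1, h2, map_smul, inner_smul_left, conj_trivial]; ring
    rw [e1, e2, ← add_mul]
    have h := integral_mul_deriv_eq_deriv_mul_of_integrable (u := ξ) (v := η)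
      (u' := deriv ξ) (v' := deriv η)
      (fun x _ => (hξ.differentiable (by simp) x).hasDerivAt)
      (fun x _ => (hη.differentiable (by simp) x).hasDerivAt)
      ((hξ.continuous.mul hη').integrable_of_hasCompactSupport hc.mul_right)
      ((hξ'.mul hη.continuous).integrable_of_hasCompactSupport hc.deriv.mul_right)
      ((hξ.continuous.mul hη.continuous).integrable_of_hasCompactSupport hc.mul_right)
    rw [h]; ring
  | zero_left q hq => simp
  | zero_right p hp => simp
  | add_left x y z _ _ _ h1 h2 =>
    simp only [Prod.fst_add, Prod.snd_add, map_add, inner_add_left]; linarith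
  | add_right x y z _ _ _ h1 h2 =>
    simp only [Prod.fst_add, Prod.snd_add, map_add, inner_add_right]; linarith
  | smul_left r x y _ _ h =>
    simp only [Prod.smul_fst, Prod.smul_snd, map_smul, inner_smul_left, conj_trivial]
    rw [← mul_add, h, mul_zero]
  | smul_right r x y _ _ h =>
    simp only [Prod.smul_fst, Prod.smul_snd, map_smul, inner_smul_right]
    rw [← mul_add, h, mul_zero]

theorem inner_testPairs_self {p : D.calF × D.calF} (hp : p ∈ D.testPairs) :
    ⟪D.toH p.1, D.toH p.2⟫_ℝ = 0 := by
  have h := D.inner_testPairs_antisymm hp hp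
  rw [real_inner_comm (D.toH p.1) (D.toH p.2)] at h
  linarith

/-- The inner product of `𝓗` on `𝓕`. -/
def innerH : D.calF →L[ℝ] D.calF →L[ℝ] ℝ :=
  ((innerₗ D.calH).compl₁₂ D.toH.toLinearMap D.toH.toLinearMap).mkContinuous₂ (‖D.toH‖ * ‖D.toH‖)
    fun u v => by
      calc ‖⟪D.toH u, D.toH v⟫_ℝ‖ ≤ ‖D.toH u‖ * ‖D.toH v‖ := norm_inner_le_norm _ _
        _ ≤ (‖D.toH‖ * ‖u‖) * (‖D.toH‖ * ‖v‖) := by gcongr <;> exact D.toH.le_opNorm _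
        _ = _ := by ring

theorem innerH_apply (u v : D.calF) : D.innerH u v = ⟪D.toH u, D.toH v⟫_ℝ := rfl

/-- A bound for `formβ`. -/
def formBound (β : ℝ) : ℝ := D.lam + |β| * (‖D.toH‖ * ‖D.toH‖)

theorem formBound_nonneg (β : ℝ) : 0 ≤ D.formBound β := by
  have := D.lam_pos
  unfold formBound
  positivity

variable [TopologicalSpace.SeparableSpace (Lp ℝ 2 m)]

/-- The form `∫ E_β^{(t)}(u(t), v(t)) dt`. -/
def formβ (β : ℝ) : D.calF →L[ℝ] D.calF →L[ℝ] ℝ :=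
  D.intE + β • D.innerH

theorem formβ_apply (β : ℝ) (u v : D.calF) :
    D.formβ β u v = D.intE u v + β * ⟪D.toH u, D.toH v⟫_ℝ := by
  simp [formβ, innerH_apply]

theorem formβ_le (β : ℝ) (u v : D.calF) : D.formβ β u v ≤ D.formBound β * ‖u‖ * ‖v‖ := by
  have h1 := (le_abs_self _).trans (D.abs_integral_E_le u v)
  have h2 : β * ⟪D.toH u, D.toH v⟫_ℝ ≤ |β| * ((‖D.toH‖ * ‖u‖) * (‖D.toH‖ * ‖v‖)) := by
    refine (le_abs_self _).trans ?_
    rw [abs_mul]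
    gcongr
    refine (abs_real_inner_le_norm _ _).trans ?_
    gcongr <;> exact D.toH.le_opNorm _
  rw [formβ_apply, intE_apply]
  calc _ ≤ _ := add_le_add h1 h2
    _ = _ := by rw [formBound]; ring

/-- Weak formulation of `-∂u/∂t + A u + β u = f`. -/
def IsWeakSolution (β : ℝ) (f : D.calH) (u : D.calF) : Prop :=
  ∀ p ∈ D.testPairs, D.formβ β u p.1 + ⟪D.toH u, D.toH p.2⟫_ℝ = ⟪f, D.toH p.1⟫_ℝ

theorem isWeakSolution_iff (β : ℝ) (f : D.calH) (u : D.calF) : D.IsWeakSolution β f u ↔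
    ∀ p ∈ D.tensorPairs, D.formβ β u p.1 + ⟪D.toH u, D.toH p.2⟫_ℝ = ⟪f, D.toH p.1⟫_ℝ := by
  refine ⟨fun h p hp => h p (Submodule.subset_span hp), fun h p hp => ?_⟩
  induction hp using Submodule.span_induction with
  | mem p hp => exact h p hp
  | zero => simp
  | add x y _ _ h1 h2 =>
    simp only [Prod.fst_add, Prod.snd_add, map_add, inner_add_right]; linarith
  | smul r x _ h =>
    simp only [Prod.smul_fst, Prod.smul_snd, map_smul, inner_smul_right, smul_eq_mul]
    rw [← mul_add, h]

/-- In Lions' theorem the derivative falls on the test function and vanishes on the diagonal, so the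
coercivity needed is that of `E_β` alone. -/
theorem exists_isWeakSolution {β : ℝ} (hβ : 0 < β) (f : D.calH) :
    ∃ u, D.IsWeakSolution β f u := by
  let R : StrongDual ℝ D.calF →ₗ[ℝ] D.calF :=
    { toFun := (InnerProductSpace.toDual ℝ D.calF).symm
      map_add' := map_add _
      map_smul' := fun c x => by simp }
  let G : D.calF × D.calF →ₗ[ℝ] StrongDual ℝ D.calF :=
    (D.formβ β).flip.toLinearMap ∘ₗ LinearMap.fst ℝ _ _ +
      D.innerH.flip.toLinearMap ∘ₗ LinearMap.snd ℝ _ _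
  have hG : ∀ p u, G p u = D.formβ β u p.1 + ⟪D.toH u, D.toH p.2⟫_ℝ := fun p u => by simp [G, innerH_apply]
  have hR : ∀ g u, ⟪R g, u⟫_ℝ = g u := fun g u => InnerProductSpace.toDual_symm_apply
  obtain ⟨u, hu⟩ := exists_inner_eq_of_coercive (R ∘ₗ G ∘ₗ D.testPairs.subtype)
    (LinearMap.fst ℝ _ _ ∘ₗ D.testPairs.subtype) (D.coer β) (D.coer_pos hβ) (fun p => by
      simp only [LinearMap.comp_apply, hR, hG, Submodule.subtype_apply, LinearMap.fst_apply,
        D.inner_testPairs_self p.2, D.formβ_apply, add_zero, real_inner_self_eq_norm_sq]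
      exact D.coer_le β hβ _) ((innerSL ℝ f).comp D.toH)
  refine ⟨u, fun p hp => ?_⟩
  have h := hu ⟨p, hp⟩
  simpa only [LinearMap.comp_apply, hR, hG, Submodule.subtype_apply, LinearMap.fst_apply,
    ContinuousLinearMap.comp_apply, innerSL_apply_apply] using h

end TimeDirichletForm

/-! ### The linear equation in 𝓦: regularity, energy and bounds -/

namespace TimeDirichletForm

variable {X : Type*} [TopologicalSpace X] [MeasurableSpace X] {m : Measure X}
  (D : TimeDirichletForm m)

/-- The Riesz representative in `𝓕` of an element of `𝓕'`. -/
def riesz : D.calF' →L[ℝ] D.calF :=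
  ((InnerProductSpace.toDual ℝ D.F).symm.toContinuousLinearEquiv.toContinuousLinearMap :
    StrongDual ℝ D.F →L[ℝ] D.F).compLpL 2 volume

/-- The element of `𝓕'` represented by an element of `𝓕`. -/
def unriesz : D.calF →L[ℝ] D.calF' :=
  ((InnerProductSpace.toDual ℝ D.F).toContinuousLinearEquiv.toContinuousLinearMap :
    D.F →L[ℝ] StrongDual ℝ D.F).compLpL 2 volume

theorem riesz_apply (ψ : D.calF') : ∀ᵐ t, ∀ v, ψ t v = ⟪D.riesz ψ t, v⟫_ℝ := by
  filter_upwards [ContinuousLinearMap.coeFn_compLpL (p := 2) (μ := (volume : Measure ℝ))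
    ((InnerProductSpace.toDual ℝ D.F).symm.toContinuousLinearEquiv.toContinuousLinearMap :
      StrongDual ℝ D.F →L[ℝ] D.F) ψ] with t ht v
  rw [riesz, ht]
  exact InnerProductSpace.toDual_symm_apply.symm

theorem unriesz_apply (q : D.calF) : ∀ᵐ t, ∀ v, D.unriesz q t v = ⟪q t, v⟫_ℝ := by
  filter_upwards [ContinuousLinearMap.coeFn_compLpL (p := 2) (μ := (volume : Measure ℝ))
    ((InnerProductSpace.toDual ℝ D.F).toContinuousLinearEquiv.toContinuousLinearMap :
      D.F →L[ℝ] StrongDual ℝ D.F) q] with t ht v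
  rw [unriesz, ht]
  exact InnerProductSpace.toDual_apply_apply

theorem norm_le_norm_riesz (ψ : D.calF') : ‖ψ‖ ≤ ‖D.riesz ψ‖ := by
  refine Lp.norm_le_norm_of_ae_le ?_
  filter_upwards [ContinuousLinearMap.coeFn_compLpL (p := 2) (μ := (volume : Measure ℝ))
    ((InnerProductSpace.toDual ℝ D.F).symm.toContinuousLinearEquiv.toContinuousLinearMap :
      StrongDual ℝ D.F →L[ℝ] D.F) ψ] with t ht
  rw [riesz, ht]
  exact ((InnerProductSpace.toDual ℝ D.F).symm.norm_map (ψ t)).ge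

theorem inner_tensor (q : D.calF) {ξ : ℝ → ℝ} (hξ : Continuous ξ) (hc : HasCompactSupport ξ)
    (v : D.F) : ⟪q, D.tensor hξ hc v⟫_ℝ = ∫ t, ξ t * ⟪q t, v⟫_ℝ := by
  rw [L2.inner_def]
  refine integral_congr_ae ?_
  filter_upwards [D.tensor_apply hξ hc v] with t h2
  rw [h2, inner_smul_right]

/-- The map `u ↦ (u, ·)_m` as a continuous linear map `F → F'`. -/
def toDualL : D.F →L[ℝ] StrongDual ℝ D.F :=
  ((innerₗ (Lp ℝ 2 m)).compl₁₂ D.inclₗ D.inclₗ).mkContinuous₂ 1 fun u v => by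
    rw [one_mul]
    exact (norm_inner_le_norm _ _).trans (mul_le_mul (D.norm_incl_le u) (D.norm_incl_le v)
      (norm_nonneg _) (norm_nonneg _))

theorem locallyIntegrable_Lp {G : Type*} [NormedAddCommGroup G]
    (f : Lp G 2 (volume : Measure ℝ)) : LocallyIntegrable f volume :=
  (Lp.memLp f).locallyIntegrable (by norm_num)

/-- Evaluating the identity in `F'` at each `v` gives the scalar form required by
`inner_weakDeriv_self_eq_zero`. -/
theorem isTimeDeriv_iff (u : D.calF) (ψ : D.calF') : D.IsTimeDeriv u ψ ↔
    ∀ (ξ : ℝ → ℝ) (v : D.F), ContDiff ℝ ∞ ξ → HasCompactSupport ξ →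
      ∫ t, ξ t * ⟪D.riesz ψ t, v⟫_ℝ = -∫ t, deriv ξ t * ⟪D.incl (u t), D.incl v⟫_ℝ := by
  have e1 : ∀ (ξ : ℝ → ℝ) (v : D.F), ContDiff ℝ ∞ ξ → HasCompactSupport ξ →
      (∫ t, ξ t • ψ t) v = ∫ t, ξ t * ⟪D.riesz ψ t, v⟫_ℝ := fun ξ v hξ hc => by
    rw [ContinuousLinearMap.integral_apply
      ((locallyIntegrable_Lp ψ).integrable_smul_left_of_hasCompactSupport hξ.continuous hc)]
    refine integral_congr_ae ?_
    filter_upwards [D.riesz_apply ψ] with t ht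
    rw [← ht]; rfl
  have e2 : ∀ (ξ : ℝ → ℝ) (v : D.F), ContDiff ℝ ∞ ξ → HasCompactSupport ξ →
      (-∫ t, deriv ξ t • D.toDual (u t)) v =
        -∫ t, deriv ξ t * ⟪D.incl (u t), D.incl v⟫_ℝ := fun ξ v hξ hc => by
    have hl : LocallyIntegrable (fun t => D.toDual (u t)) volume :=
      (locallyIntegrable_Lp (D.toDualL.compLpL 2 volume u)).congr
        (D.toDualL.coeFn_compLpL (p := 2) (μ := (volume : Measure ℝ)) u)
    rw [neg_apply, ContinuousLinearMap.integral_apply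
      (hl.integrable_smul_left_of_hasCompactSupport (hξ.continuous_deriv (by simp)) hc.deriv)]
    rfl
  refine ⟨fun h ξ v hξ hc => ?_, fun h ξ hξ hc => ?_⟩
  · rw [← e1 ξ v hξ hc, ← e2 ξ v hξ hc, h ξ hξ hc]
  · ext v
    rw [e1 ξ v hξ hc, e2 ξ v hξ hc, h ξ v hξ hc]

theorem MemW.isTimeDeriv {D : TimeDirichletForm m} {u : D.calF} (h : D.MemW u) :
    D.IsTimeDeriv u (D.timeDeriv u) := by
  obtain ⟨ψ, hψ⟩ := h
  rwa [hψ.timeDeriv_eq]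

theorem inner_riesz_timeDeriv_self {u : D.calF} (h : D.MemW u) :
    ⟪D.riesz (D.timeDeriv u), u⟫_ℝ = 0 :=
  inner_weakDeriv_self_eq_zero D.incl _ u ((D.isTimeDeriv_iff u _).mp h.isTimeDeriv)

theorem IsTimeDeriv.sub {D : TimeDirichletForm m} {u v : D.calF} {ψ χ : D.calF'}
    (hu : D.IsTimeDeriv u ψ) (hv : D.IsTimeDeriv v χ) : D.IsTimeDeriv (u - v) (ψ - χ) := by
  rw [isTimeDeriv_iff] at *
  intro ξ w hξ hc
  have h1 := hu ξ w hξ hc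
  have h2 := hv ξ w hξ hc
  have e : ∀ x : D.calF, ∫ t, deriv ξ t * ⟪D.incl (x t), D.incl w⟫_ℝ =
      ⟪D.toH x, D.toH (D.tensor (hξ.continuous_deriv (by simp)) hc.deriv w)⟫_ℝ := fun x => by
    rw [inner_toH_tensor]
    refine integral_congr_ae ?_
    filter_upwards [D.toH_apply x] with t ht
    rw [ht]
  rw [← inner_tensor D _ hξ.continuous hc, e] at *
  rw [map_sub, map_sub, inner_sub_left, inner_sub_left, h1, h2]
  ring

/-- `u ∈ 𝓦` solves `-∂u/∂t + A u + β u = f`. -/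
def SolvesLinear (β : ℝ) (f : D.calH) (u : D.calF) : Prop :=
  D.MemW u ∧ ∀ᵐ t : ℝ, ∀ v : D.F,
    -(D.timeDeriv u t v) + (D.E t (u t) v + β * ⟪D.incl (u t), D.incl v⟫_ℝ) = ⟪f t, D.incl v⟫_ℝ

theorem SolvesLinear.sub {D : TimeDirichletForm m} {β : ℝ} {f g : D.calH} {u v : D.calF}
    (hu : D.SolvesLinear β f u) (hv : D.SolvesLinear β g v) :
    D.SolvesLinear β (f - g) (u - v) := by
  have h := hu.1.isTimeDeriv.sub hv.1.isTimeDeriv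
  refine ⟨⟨_, h⟩, ?_⟩
  rw [h.timeDeriv_eq]
  filter_upwards [hu.2, hv.2, Lp.coeFn_sub f g, Lp.coeFn_sub u v,
    Lp.coeFn_sub (D.timeDeriv u) (D.timeDeriv v)] with t h1 h2 h3 h4 h5 w
  rw [h3, h4, h5]
  simp only [Pi.sub_apply, map_sub, inner_sub_left, LinearMap.sub_apply,
    sub_apply]
  linarith [h1 w, h2 w]

theorem solvesLinear_shift {β : ℝ} (γ : ℝ) {f : D.calH} {u : D.calF} :
    D.SolvesLinear β f u ↔ D.SolvesLinear (β + γ) (f + γ • D.toH u) u := by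
  refine and_congr_right fun _ => eventually_congr ?_
  filter_upwards [Lp.coeFn_add f (γ • D.toH u), Lp.coeFn_smul γ (D.toH u), D.toH_apply u]
    with t h1 h2 h3
  refine forall_congr' fun v => ?_
  rw [h1, Pi.add_apply, h2, Pi.smul_apply, h3, inner_add_left, inner_smul_left, conj_trivial]
  constructor <;> intro h <;> linarith

/-- A constant bounding `‖u‖_𝓦` by `‖f‖_𝓗`. -/
def bddConst (β : ℝ) : ℝ :=
  D.formBound β * ((D.coer β)⁻¹ * ‖D.toH‖) + ‖D.toH‖ + (D.coer β)⁻¹ * ‖D.toH‖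

theorem bddConst_nonneg {β : ℝ} (hβ : 0 < β) : 0 ≤ D.bddConst β := by
  have := D.coer_pos hβ
  have := D.formBound_nonneg β
  unfold bddConst
  positivity

variable [TopologicalSpace.SeparableSpace (Lp ℝ 2 m)]

theorem SolvesLinear.test {D : TimeDirichletForm m} {β : ℝ} {f : D.calH} {u : D.calF}
    (hu : D.SolvesLinear β f u) (p : D.calF) :
    D.formβ β u p = ⟪f, D.toH p⟫_ℝ + ⟪D.riesz (D.timeDeriv u), p⟫_ℝ := by
  rw [formβ_apply, intE_apply, L2.inner_def, L2.inner_def, L2.inner_def, ← integral_const_mul,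
    ← integral_add (D.integrable_E u p) ((L2.integrable_inner _ _).const_mul _),
    ← integral_add (L2.integrable_inner _ _) (L2.integrable_inner _ _)]
  refine integral_congr_ae ?_
  filter_upwards [hu.2, D.riesz_apply (D.timeDeriv u), D.toH_apply u, D.toH_apply p]
    with t h1 h2 h3 h4
  rw [h3, h4, ← h1, ← h2]
  ring

theorem SolvesLinear.energy {D : TimeDirichletForm m} {β : ℝ} {f : D.calH} {u : D.calF}
    (hu : D.SolvesLinear β f u) : D.intE u u + β * ‖D.toH u‖ ^ 2 = ⟪f, D.toH u⟫_ℝ := by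
  have h := hu.test u
  rwa [D.inner_riesz_timeDeriv_self hu.1, add_zero, formβ_apply, real_inner_self_eq_norm_sq] at h

theorem SolvesLinear.isWeakSolution {D : TimeDirichletForm m} {β : ℝ} {f : D.calH} {u : D.calF}
    (hu : D.SolvesLinear β f u) : D.IsWeakSolution β f u := by
  rw [isWeakSolution_iff]
  rintro _ ⟨ξ, v, hξ, hc, rfl⟩
  have h := (D.isTimeDeriv_iff u _).mp hu.1.isTimeDeriv ξ v hξ hc
  have e : ∫ t, deriv ξ t * ⟪D.incl (u t), D.incl v⟫_ℝ =
      ⟪D.toH u, D.toH (D.tensor (hξ.continuous_deriv (by simp)) hc.deriv v)⟫_ℝ := by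
    rw [inner_toH_tensor]
    refine integral_congr_ae ?_
    filter_upwards [D.toH_apply u] with t ht
    rw [ht]
  rw [← inner_tensor D _ hξ.continuous hc, e] at h
  rw [hu.test, h]
  ring

theorem intE_tensor (u : D.calF) {ξ : ℝ → ℝ} (hξ : Continuous ξ) (hc : HasCompactSupport ξ)
    (v : D.F) : D.intE u (D.tensor hξ hc v) = ∫ t, ξ t * D.E t (u t) v := by
  rw [intE_apply]
  refine integral_congr_ae ?_
  filter_upwards [D.tensor_apply hξ hc v] with t h2
  rw [h2, map_smul, smul_eq_mul]

/-- The functional `p ↦ ∫ E_β(u, p) dt - (f, p)` is bounded on 𝓕, and the weak equation says that it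
is `∂u/∂t`. The pointwise equation follows from the fundamental lemma of the calculus of variations.
-/
theorem IsWeakSolution.solvesLinear {D : TimeDirichletForm m} {β : ℝ} {f : D.calH} {u : D.calF}
    (hu : D.IsWeakSolution β f u) : D.SolvesLinear β f u := by
  set q : D.calF := (InnerProductSpace.toDual ℝ D.calF).symm
    (D.formβ β u - (innerSL ℝ f).comp D.toH) with hq
  have hq' : ∀ p, ⟪q, p⟫_ℝ = D.formβ β u p - ⟪f, D.toH p⟫_ℝ := fun p =>
    InnerProductSpace.toDual_symm_apply
  have hd : D.IsTimeDeriv u (D.unriesz q) := by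
    rw [isTimeDeriv_iff]
    intro ξ v hξ hc
    have h := (D.isWeakSolution_iff β f u).mp hu _ ⟨ξ, v, hξ, hc, rfl⟩
    have e : ∫ t, deriv ξ t * ⟪D.incl (u t), D.incl v⟫_ℝ =
        ⟪D.toH u, D.toH (D.tensor (hξ.continuous_deriv (by simp)) hc.deriv v)⟫_ℝ := by
      rw [inner_toH_tensor]
      refine integral_congr_ae ?_
      filter_upwards [D.toH_apply u] with t ht
      rw [ht]
    have e' : ∫ t, ξ t * ⟪D.riesz (D.unriesz q) t, v⟫_ℝ = ⟪q, D.tensor hξ.continuous hc v⟫_ℝ := by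
      rw [inner_tensor]
      refine integral_congr_ae ?_
      filter_upwards [D.riesz_apply (D.unriesz q), D.unriesz_apply q] with t h1 h2
      rw [← h1, h2]
    rw [e, e', hq']
    linarith
  have hv : ∀ v : D.F, ∀ᵐ t, (⟪f t, D.incl v⟫_ℝ + ⟪q t, v⟫_ℝ) -
      (D.E t (u t) v + β * ⟪D.toH u t, D.incl v⟫_ℝ) = 0 := fun v => by
    have i1 : LocallyIntegrable (fun t => ⟪f t, D.incl v⟫_ℝ) volume :=
      ((Lp.memLp f).inner_const _).locallyIntegrable (by norm_num)
    have i2 : LocallyIntegrable (fun t => ⟪q t, v⟫_ℝ) volume :=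
      ((Lp.memLp q).inner_const _).locallyIntegrable (by norm_num)
    have i3 : LocallyIntegrable (fun t => D.E t (u t) v) volume := by
      refine MemLp.locallyIntegrable (p := 2) ?_ (by norm_num)
      refine (Lp.memLp u).of_le_mul (c := D.lam * ‖v‖)
        (D.aestronglyMeasurable_E (Lp.aestronglyMeasurable u) aestronglyMeasurable_const)
        (Eventually.of_forall fun t => ?_)
      have := D.abs_E_le t (u t) v
      rw [Real.norm_eq_abs]; linarith
    have i4 : LocallyIntegrable (fun t => β * ⟪D.toH u t, D.incl v⟫_ℝ) volume :=
      (((Lp.memLp (D.toH u)).inner_const _).const_mul β).locallyIntegrable (by norm_num)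
    refine ae_eq_zero_of_integral_contDiff_smul_eq_zero ((i1.add i2).sub (i3.add i4))
      fun ξ hξ hc => ?_
    have j : ∀ {k : ℝ → ℝ}, LocallyIntegrable k volume → Integrable (fun t => ξ t * k t) volume :=
      fun hk => hk.integrable_smul_left_of_hasCompactSupport hξ.continuous hc
    have h := hq' (D.tensor hξ.continuous hc v)
    rw [inner_tensor, formβ_apply, intE_tensor, inner_toH_tensor, inner_toH_tensor,
      ← integral_const_mul] at h
    simp only [smul_eq_mul, mul_sub, mul_add]
    rw [integral_sub, integral_add (j i1) (j i2), integral_add (j i3) (j i4), h]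
    rotate_left
    · exact (j i1).add (j i2)
    · exact (j i3).add (j i4)
    simp only [mul_left_comm]
    ring
  refine ⟨⟨_, hd⟩, ?_⟩
  rw [hd.timeDeriv_eq]
  -- The null set in `hv` depends on `v`; a countable dense set of `v` and continuity in `v` give
  -- one null set for all.
  obtain ⟨s, hsc, hsd⟩ := TopologicalSpace.exists_countable_dense D.F
  filter_upwards [(ae_ball_iff hsc).mpr fun v _ => hv v, D.unriesz_apply q, D.toH_apply u]
    with t h1 h2 h3 v
  rw [h2]
  have hc : Continuous fun v => (⟪f t, D.incl v⟫_ℝ + ⟪q t, v⟫_ℝ) -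
      (D.E t (u t) v + β * ⟪D.toH u t, D.incl v⟫_ℝ) := by
    have : Continuous fun v => D.E t (u t) v := (D.Ec t (u t)).continuous
    fun_prop
  have h4 := congrFun (hc.ext_on hsd continuous_const fun v hv => h1 v hv) v
  simp only [h3] at h4
  linarith

theorem exists_solvesLinear {β : ℝ} (hβ : 0 < β) (f : D.calH) : ∃ u, D.SolvesLinear β f u :=
  (D.exists_isWeakSolution hβ f).imp fun _ h => h.solvesLinear

theorem SolvesLinear.norm_toH_le {D : TimeDirichletForm m} {β : ℝ} {f : D.calH}
    {u : D.calF} (hu : D.SolvesLinear β f u) : β * ‖D.toH u‖ ≤ ‖f‖ := by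
  rcases (norm_nonneg (D.toH u)).eq_or_lt with h | h
  · rw [← h, mul_zero]; exact norm_nonneg f
  · have h1 := hu.energy
    have h2 := D.intE_self_nonneg u
    have h3 := real_inner_le_norm f (D.toH u)
    refine le_of_mul_le_mul_right ?_ h
    nlinarith

/-- Coercivity and the energy identity bound `u` in 𝓕; testing the equation with the Riesz
representative of `∂u/∂t` bounds the derivative. -/
theorem SolvesLinear.normW_le {D : TimeDirichletForm m} {β : ℝ} (hβ : 0 < β) {f : D.calH}
    {u : D.calF} (hu : D.SolvesLinear β f u) : D.normW u ≤ D.bddConst β * ‖f‖ := by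
  have hc := D.coer_pos hβ
  have hb := D.formBound_nonneg β
  have h1 : ‖u‖ ≤ (D.coer β)⁻¹ * ‖D.toH‖ * ‖f‖ := by
    rcases (norm_nonneg u).eq_or_lt with h | h
    · rw [← h]; positivity
    · have h1 := D.coer_le β hβ u
      rw [hu.energy] at h1
      have h2 : ⟪f, D.toH u⟫_ℝ ≤ ‖f‖ * (‖D.toH‖ * ‖u‖) := (real_inner_le_norm _ _).trans
        (by gcongr; exact D.toH.le_opNorm u)
      have h3 : D.coer β * ‖u‖ ≤ ‖D.toH‖ * ‖f‖ := le_of_mul_le_mul_right (by linarith) h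
      rw [mul_assoc, inv_mul_eq_div, le_div_iff₀ hc]; linarith
  have h2 : ‖D.timeDeriv u‖ ≤ D.formBound β * ‖u‖ + ‖D.toH‖ * ‖f‖ := by
    refine (D.norm_le_norm_riesz _).trans ?_
    set q := D.riesz (D.timeDeriv u) with hq
    rcases (norm_nonneg q).eq_or_lt with h | h
    · rw [← h]; positivity
    · refine le_of_mul_le_mul_right ?_ h
      have h3 := hu.test q
      rw [← hq, real_inner_self_eq_norm_sq] at h3
      have h4 : D.formβ β u q ≤ D.formBound β * ‖u‖ * ‖q‖ :=
        D.formβ_le β u q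
      have h5 : -⟪f, D.toH q⟫_ℝ ≤ ‖f‖ * (‖D.toH‖ * ‖q‖) :=
        ((neg_le_abs _).trans (abs_real_inner_le_norm _ _)).trans
          (by gcongr; exact D.toH.le_opNorm q)
      linarith
  have h3 : D.normW u ≤ ‖D.timeDeriv u‖ + ‖u‖ := by
    rw [normW, Real.sqrt_le_left (by positivity)]
    nlinarith [mul_nonneg (norm_nonneg (D.timeDeriv u)) (norm_nonneg u)]
  calc D.normW u ≤ ‖D.timeDeriv u‖ + ‖u‖ := h3
    _ ≤ D.formBound β * ‖u‖ + ‖D.toH‖ * ‖f‖ + ‖u‖ := by gcongr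
    _ ≤ D.formBound β * ((D.coer β)⁻¹ * ‖D.toH‖ * ‖f‖) + ‖D.toH‖ * ‖f‖ +
        (D.coer β)⁻¹ * ‖D.toH‖ * ‖f‖ := by gcongr
    _ = _ := by rw [bddConst]; ring

end TimeDirichletForm

/-! ### Order structure of `L²`, monotonicity of the penalty, weak compactness -/

section LatticeLp

variable {Ω V : Type*} [MeasurableSpace Ω] {μ : Measure Ω} [NormedAddCommGroup V] [Lattice V]
  [HasSolidNorm V] [IsOrderedAddMonoid V]

theorem coeFn_negPart_Lp (f : Lp V 2 μ) : ∀ᵐ x ∂μ, (f⁻) x = (f x)⁻ := by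
  rw [negPart_def]
  filter_upwards [Lp.coeFn_sup (-f) 0, Lp.coeFn_neg f, Lp.coeFn_zero V 2 μ] with x h1 h2 h3
  rw [h1, Pi.sup_apply, h2, h3, negPart_def]
  rfl

theorem coeFn_posPart_Lp (f : Lp V 2 μ) : ∀ᵐ x ∂μ, (f⁺) x = (f x)⁺ := by
  rw [posPart_def]
  filter_upwards [Lp.coeFn_sup f 0, Lp.coeFn_zero V 2 μ] with x h1 h3
  rw [h1, Pi.sup_apply, h3, posPart_def]
  rfl

end LatticeLp

section LatticeL2

variable {Ω V : Type*} [MeasurableSpace Ω] {μ : Measure Ω} [NormedAddCommGroup V] [Lattice V]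

variable [InnerProductSpace ℝ V]

/-- The cone property of `V` is a hypothesis so that the lemma can be iterated, from `ℝ` to `L²(m)`
and then to 𝓗. -/
theorem L2_inner_nonneg (h : ∀ a b : V, 0 ≤ a → 0 ≤ b → 0 ≤ ⟪a, b⟫_ℝ) (f g : Lp V 2 μ)
    (hf : 0 ≤ f) (hg : 0 ≤ g) : 0 ≤ ⟪f, g⟫_ℝ := by
  rw [L2.inner_def]
  refine integral_nonneg_of_ae ?_
  filter_upwards [(Lp.coeFn_nonneg f).mpr hf, (Lp.coeFn_nonneg g).mpr hg] with x h1 h2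
  exact h _ _ h1 h2

theorem real_inner_posPart_negPart (a : ℝ) : ⟪a⁺, a⁻⟫_ℝ = 0 := by
  rw [RCLike.inner_apply, conj_trivial, posPart_def, negPart_def]
  rcases le_total 0 a with h | h <;> simp [h]

/-- The monotonicity estimate behind the Cauchy property of penalized solutions. -/
theorem inner_penalty_sub_le (hn : ∀ a b : V, 0 ≤ a → 0 ≤ b → 0 ≤ ⟪a, b⟫_ℝ)
    (ho : ∀ a : V, ⟪a⁺, a⁻⟫_ℝ = 0) (hns : ∀ a : V, 0 ≤ a⁻ ∧ 0 ≤ a⁺ ∧ a⁺ - a⁻ = a)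
    {ε δ R : ℝ} (hε : 0 < ε) (hδ : 0 < δ) (a b : V)
    (ha : 1 / ε * ‖a⁻‖ ≤ R) (hb : 1 / δ * ‖b⁻‖ ≤ R) :
    ⟪(1 / ε) • a⁻ - (1 / δ) • b⁻, a - b⟫_ℝ ≤ (ε + δ) * R ^ 2 := by
  set x := (1 / ε) • a⁻ with hx
  set y := (1 / δ) • b⁻ with hy
  -- With `a = a⁺ - εx` and `b = b⁺ - δy`, the product is `(ε + δ)⟨x, y⟩` minus the nonnegative
  -- terms `ε‖x‖²`, `δ‖y‖²`, `⟨x, b⁺⟩`, `⟨y, a⁺⟩`.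
  have hxa : a = a⁺ - ε • x := by
    rw [hx, smul_smul, mul_one_div_cancel hε.ne', one_smul, (hns a).2.2]
  have hyb : b = b⁺ - δ • y := by
    rw [hy, smul_smul, mul_one_div_cancel hδ.ne', one_smul, (hns b).2.2]
  have h1 : ⟪x, a⁺⟫_ℝ = 0 := by
    rw [hx, inner_smul_left, real_inner_comm, ho, mul_zero]
  have h2 : ⟪y, b⁺⟫_ℝ = 0 := by
    rw [hy, inner_smul_left, real_inner_comm, ho, mul_zero]
  have h3 : 0 ≤ ⟪x, b⁺⟫_ℝ := by
    rw [hx, inner_smul_left, conj_trivial]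
    exact mul_nonneg (by positivity) (hn _ _ (hns a).1 (hns b).2.1)
  have h4 : 0 ≤ ⟪y, a⁺⟫_ℝ := by
    rw [hy, inner_smul_left, conj_trivial]
    exact mul_nonneg (by positivity) (hn _ _ (hns b).1 (hns a).2.1)
  have hxR : ‖x‖ ≤ R := by
    rwa [hx, norm_smul, Real.norm_of_nonneg (by positivity)]
  have hyR : ‖y‖ ≤ R := by
    rwa [hy, norm_smul, Real.norm_of_nonneg (by positivity)]
  have h5 : ⟪x, y⟫_ℝ ≤ R ^ 2 := by
    rw [pow_two]
    exact (real_inner_le_norm _ _).trans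
      (mul_le_mul hxR hyR (norm_nonneg _) ((norm_nonneg _).trans hxR))
  rw [hxa, hyb]
  simp only [inner_sub_left, inner_sub_right, inner_smul_right, h1, h2, real_inner_comm x y]
  nlinarith [mul_nonneg hε.le (real_inner_self_nonneg (x := x) (F := V)),
    mul_nonneg hδ.le (real_inner_self_nonneg (x := y) (F := V)), add_pos hε hδ]

variable [HasSolidNorm V] [IsOrderedAddMonoid V]

theorem L2_inner_posPart_negPart (h : ∀ a : V, ⟪a⁺, a⁻⟫_ℝ = 0) (f : Lp V 2 μ) :
    ⟪f⁺, f⁻⟫_ℝ = 0 := by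
  rw [L2.inner_def]
  refine integral_eq_zero_of_ae ?_
  filter_upwards [coeFn_negPart_Lp f, coeFn_posPart_Lp f] with x h1 h2
  rw [h1, h2, h]
  rfl

end LatticeL2

theorem exists_weak_limit {V : Type*} [NormedAddCommGroup V] [InnerProductSpace ℝ V]
    [CompleteSpace V] [TopologicalSpace.SeparableSpace V] (f : ℕ → V) (R : ℝ)
    (hf : ∀ n, ‖f n‖ ≤ R) :
    ∃ (x : V) (k : ℕ → ℕ), StrictMono k ∧ ‖x‖ ≤ R ∧
      ∀ v, Tendsto (fun n => ⟪f (k n), v⟫_ℝ) atTop (𝓝 ⟪x, v⟫_ℝ) := by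
  obtain ⟨x, hx, k, hk, hlim⟩ := WeakDual.isSeqCompact_closedBall ℝ V 0 R
    (x := fun n => StrongDual.toWeakDual (InnerProductSpace.toDual ℝ V (f n)))
    (fun n => by simpa using hf n)
  refine ⟨(InnerProductSpace.toDual ℝ V).symm (WeakDual.toStrongDual x), k, hk, ?_, fun v => ?_⟩
  · rw [LinearIsometryEquiv.norm_map]
    simpa using hx
  · rw [InnerProductSpace.toDual_symm_apply]
    exact ((WeakDual.eval_continuous v).tendsto x).comp hlim

/-! ### The penalized problem -/

namespace TimeDirichletForm

variable {X : Type*} [TopologicalSpace X] [MeasurableSpace X] {m : Measure X}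
  (D : TimeDirichletForm m)

theorem isPenalizedSolution_iff {α ε : ℝ} {g u : D.calF} :
    D.IsPenalizedSolution α ε g u ↔
      D.SolvesLinear α ((1 / ε) • (D.toH u - D.toH g)⁻) u := by
  refine and_congr_right fun _ => eventually_congr ?_
  filter_upwards [Lp.coeFn_smul (1 / ε) (D.toH u - D.toH g)⁻,
    coeFn_negPart_Lp (D.toH u - D.toH g), Lp.coeFn_sub (D.toH u) (D.toH g), D.toH_apply u,
    D.toH_apply g] with t h1 h2 h3 h4 h5
  refine forall_congr' fun v => ?_
  rw [h1, Pi.smul_apply, h2, h3, Pi.sub_apply, h4, h5, inner_smul_left, conj_trivial]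

/-- Since `(u - g)⁻ + u = u ∨ g`, shifting by `1/ε` leaves a source whose Lipschitz constant `1/ε`
is smaller than the new parameter `α + 1/ε`. -/
theorem isPenalizedSolution_iff_sup {α ε : ℝ} {g u : D.calF} :
    D.IsPenalizedSolution α ε g u ↔
      D.SolvesLinear (α + 1 / ε) ((1 / ε) • (D.toH u ⊔ D.toH g)) u := by
  rw [isPenalizedSolution_iff, D.solvesLinear_shift (1 / ε), ← smul_add]
  have h : (D.toH u - D.toH g)⁻ + D.toH u = D.toH u ⊔ D.toH g := by
    rw [negPart_def, sup_add, neg_sub, sub_add_cancel, zero_add, sup_comm]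
  rw [h]

theorem norm_smul_sup_sub_le {ε : ℝ} (hε : 0 < ε) (x y g : D.calH) :
    ‖(1 / ε) • (x ⊔ g) - (1 / ε) • (y ⊔ g)‖ ≤ 1 / ε * ‖x - y‖ := by
  rw [← smul_sub, norm_smul, Real.norm_of_nonneg (by positivity)]
  gcongr
  simpa using norm_sup_sub_sup_le_add_norm x g y g

variable [TopologicalSpace.SeparableSpace (Lp ℝ 2 m)]

theorem SolvesLinear.unique {D : TimeDirichletForm m} {β : ℝ} (hβ : 0 < β) {f : D.calH}
    {u v : D.calF} (hu : D.SolvesLinear β f u) (hv : D.SolvesLinear β f v) : u = v := by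
  have h := (hu.sub hv).energy
  rw [sub_self, inner_zero_left] at h
  have h2 := D.coer_le β hβ (u - v)
  rw [h] at h2
  have h3 : ‖u - v‖ ^ 2 ≤ 0 := nonpos_of_mul_nonpos_right h2 (D.coer_pos hβ)
  have h4 : ‖u - v‖ = 0 := pow_eq_zero_iff (two_ne_zero) |>.mp (le_antisymm h3 (sq_nonneg _))
  exact sub_eq_zero.mp (norm_eq_zero.mp h4)

/-- The estimate `(α + 1/ε)‖u - v‖ ≤ ε⁻¹‖u - v‖` in 𝓗 forces equality there; both then solve the
same linear problem. -/
theorem IsPenalizedSolution.unique {D : TimeDirichletForm m} {α ε : ℝ} (hα : 0 < α) (hε : 0 < ε)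
    {g u v : D.calF} (hu : D.IsPenalizedSolution α ε g u) (hv : D.IsPenalizedSolution α ε g v) :
    u = v := by
  have hu' := D.isPenalizedSolution_iff_sup.mp hu
  have hv' := D.isPenalizedSolution_iff_sup.mp hv
  have h := (hu'.sub hv').norm_toH_le.trans (D.norm_smul_sup_sub_le hε _ _ _)
  rw [map_sub] at h
  have h2 : D.toH u = D.toH v := by
    rw [← sub_eq_zero, ← norm_le_zero_iff]
    refine nonpos_of_mul_nonpos_right (a := α) ?_ hα
    linarith
  rw [h2] at hu'
  exact hu'.unique (by positivity) hv'

theorem exists_isPenalizedSolution {α ε : ℝ} (hα : 0 < α) (hε : 0 < ε) (g : D.calF) :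
    ∃ u, D.IsPenalizedSolution α ε g u := by
  have hβ : 0 < α + 1 / ε := by positivity
  choose S hS using fun x : D.calH => D.exists_solvesLinear hβ ((1 / ε) • (x ⊔ D.toH g))
  have hr : 0 ≤ 1 / ε / (α + 1 / ε) := by positivity
  have hc : ContractingWith (Real.toNNReal (1 / ε / (α + 1 / ε))) fun x => D.toH (S x) := by
    refine ⟨?_, LipschitzWith.of_dist_le_mul fun x y => ?_⟩
    · rw [Real.toNNReal_lt_one, div_lt_one hβ]
      linarith
    · have h := ((hS x).sub (hS y)).norm_toH_le.trans (D.norm_smul_sup_sub_le hε _ _ _)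
      rw [dist_eq_norm, dist_eq_norm, ← map_sub, Real.coe_toNNReal _ hr, div_mul_eq_mul_div, le_div_iff₀ hβ]
      linarith
  -- The fixed point lives only in 𝓗; applying `S` once more gives its representative in 𝓦.
  refine ⟨S (ContractingWith.fixedPoint _ hc), D.isPenalizedSolution_iff_sup.mpr ?_⟩
  have h := hS (ContractingWith.fixedPoint _ hc)
  have hfix : D.toH (S (ContractingWith.fixedPoint _ hc)) = ContractingWith.fixedPoint _ hc :=
    hc.fixedPoint_isFixedPt
  rwa [hfix]

theorem IsPenalizedSolution.coer_norm_sub_le {D : TimeDirichletForm m} {α ε δ R : ℝ} (hα : 0 < α)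
    (hε : 0 < ε) (hδ : 0 < δ) {g u v : D.calF} (hu : D.IsPenalizedSolution α ε g u)
    (hv : D.IsPenalizedSolution α δ g v) (huR : 1 / ε * ‖(D.toH u - D.toH g)⁻‖ ≤ R)
    (hvR : 1 / δ * ‖(D.toH v - D.toH g)⁻‖ ≤ R) :
    D.coer α * ‖u - v‖ ^ 2 ≤ (ε + δ) * R ^ 2 := by
  refine (D.coer_le α hα (u - v)).trans ?_
  rw [((D.isPenalizedSolution_iff.mp hu).sub (D.isPenalizedSolution_iff.mp hv)).energy]
  have h := inner_penalty_sub_le (V := D.calH)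
    (L2_inner_nonneg (L2_inner_nonneg fun a b ha hb => by
      rw [RCLike.inner_apply, conj_trivial]; positivity))
    (L2_inner_posPart_negPart (L2_inner_posPart_negPart real_inner_posPart_negPart))
    (fun a => ⟨negPart_nonneg a, posPart_nonneg a, posPart_sub_negPart a⟩)
    hε hδ _ _ huR hvR
  rwa [sub_sub_sub_cancel_right, ← map_sub D.toH u v] at h

/-- With the derivative on the test function, no convergence of `∂u/∂t` is needed, and weak
convergence of the sources suffices. -/
theorem IsWeakSolution.of_tendsto {D : TimeDirichletForm m} {β : ℝ} {f : ℕ → D.calH} {u : ℕ → D.calF}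
    {f₀ : D.calH} {u₀ : D.calF} (h : ∀ n, D.IsWeakSolution β (f n) (u n))
    (hu : Tendsto u atTop (𝓝 u₀)) (hf : ∀ v, Tendsto (fun n => ⟪f n, v⟫_ℝ) atTop (𝓝 ⟪f₀, v⟫_ℝ)) :
    D.IsWeakSolution β f₀ u₀ := by
  intro p hp
  have hc : Continuous fun u => D.formβ β u p.1 + ⟪D.toH u, D.toH p.2⟫_ℝ := by fun_prop
  exact tendsto_nhds_unique ((hc.tendsto u₀).comp hu)
    ((hf (D.toH p.1)).congr fun n => (h n p hp).symm)

end TimeDirichletForm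

end

/-! ### Uniform bounds and passage to the limit -/

theorem mainTheorem7 {X : Type*} [MetricSpace X] [LocallyCompactSpace X]
    [TopologicalSpace.SeparableSpace X] [MeasurableSpace X] [BorelSpace X]
    (m : Measure X) [m.Regular] [m.IsOpenPosMeasure]
    (D : TimeDirichletForm m) (α : ℝ) (hα : 0 < α) (K : ℝ) :
    ∃ K₄ K₅ : ℝ, 0 ≤ K₄ ∧ 0 ≤ K₅ ∧
      ∀ g φ : D.calF, D.MemW g → D.MemW φ → D.IsExcessive α φ →
        |D.toH g| ≤ D.toH φ →
        (∀ ε : ℝ, 0 < ε → ∀ u : D.calF, D.IsPenalizedSolution α ε g u →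
          1 / ε * ‖(D.toH u - D.toH g)⁻‖ ≤ K * ‖D.toH g‖) →
        ∃ (gε : ℝ → D.calF) (e : D.calF),
          (∀ ε : ℝ, 0 < ε → D.IsPenalizedSolution α ε g (gε ε) ∧
            ∀ u : D.calF, D.IsPenalizedSolution α ε g u → u = gε ε) ∧
          Tendsto (fun ε => D.toH (gε ε)) (𝓝[>] 0) (𝓝 (D.toH e)) ∧
          (∀ ε : ℝ, 0 < ε → D.normW (gε ε) ≤ K₄ * D.normW φ + K₅ * ‖D.toH g‖) ∧
          D.MemW e ∧
          D.normW e ≤ K₄ * D.normW φ + K₅ * ‖D.toH g‖ := by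

  -- Second countability makes `L²(m)`, and then 𝓗, separable, as the weak subsequence requires.
  have : SecondCountableTopology X := UniformSpace.secondCountable_of_separable X
  have : Fact ((2 : ENNReal) ≠ ⊤) := ⟨by norm_num⟩
  -- `K` may be negative; `|K|` keeps the constant nonnegative.
  refine ⟨0, D.bddConst α * |K|, le_rfl, mul_nonneg (D.bddConst_nonneg hα) (abs_nonneg K), ?_⟩
  intro g φ _ _ _ _ hK
  choose! gε hgε using fun (ε : ℝ) (hε : 0 < ε) => D.exists_isPenalizedSolution hα hε g
  have hR : ∀ ε : ℝ, 0 < ε → 1 / ε * ‖(D.toH (gε ε) - D.toH g)⁻‖ ≤ |K| * ‖D.toH g‖ :=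
    fun ε hε => (hK ε hε _ (hgε ε hε)).trans
      (mul_le_mul_of_nonneg_right (le_abs_self K) (norm_nonneg _))
  set R := |K| * ‖D.toH g‖ with hRdef
  have hfR : ∀ ε : ℝ, 0 < ε → ‖(1 / ε) • (D.toH (gε ε) - D.toH g)⁻‖ ≤ R := fun ε hε => by
    rw [norm_smul, Real.norm_of_nonneg (by positivity)]
    exact hR ε hε
  have hsol : ∀ ε : ℝ, 0 < ε →
      D.SolvesLinear α ((1 / ε) • (D.toH (gε ε) - D.toH g)⁻) (gε ε) :=
    fun ε hε => D.isPenalizedSolution_iff.mp (hgε ε hε)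
  have hbound : ∀ (f : D.calH) (u : D.calF), D.SolvesLinear α f u → ‖f‖ ≤ R →
      D.normW u ≤ 0 * D.normW φ + D.bddConst α * |K| * ‖D.toH g‖ := fun f u hu hf => by
    rw [zero_mul, zero_add, mul_assoc]
    exact (hu.normW_le hα).trans (mul_le_mul_of_nonneg_left hf (D.bddConst_nonneg hα))
  have hcpos := D.coer_pos hα
  have hcauchy : Cauchy (map gε (𝓝[>] 0)) := by
    rw [Metric.cauchy_iff]
    refine ⟨inferInstance, fun r hr => ?_⟩
    have hlim : Tendsto (fun ε : ℝ => 2 * ε * R ^ 2) (𝓝[>] 0) (𝓝 0) := by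
      have : Continuous fun ε : ℝ => 2 * ε * R ^ 2 := by fun_prop
      simpa using (this.tendsto 0).mono_left nhdsWithin_le_nhds
    have hev := hlim.eventually_lt_const (mul_pos hcpos (pow_pos hr 2))
    refine ⟨_, image_mem_map (hev.and self_mem_nhdsWithin), ?_⟩
    rintro _ ⟨ε, ⟨h1, hε⟩, rfl⟩ _ ⟨δ, ⟨h2, hδ⟩, rfl⟩
    have h3 := (hgε ε hε).coer_norm_sub_le hα hε hδ (hgε δ hδ) (hR ε hε) (hR δ hδ)
    rw [dist_eq_norm]
    have h4 : D.coer α * ‖gε ε - gε δ‖ ^ 2 < D.coer α * r ^ 2 := by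
      have h1' : 2 * ε * R ^ 2 < D.coer α * r ^ 2 := h1
      have h2' : 2 * δ * R ^ 2 < D.coer α * r ^ 2 := h2
      linarith
    exact lt_of_pow_lt_pow_left₀ 2 hr.le (lt_of_mul_lt_mul_left h4 hcpos.le)
  obtain ⟨e, he⟩ := cauchy_map_iff_exists_tendsto.mp hcauchy
  have hpos : ∀ n : ℕ, (0 : ℝ) < 1 / ((n : ℝ) + 1) := fun n => by positivity
  -- A subsequence of `ε = 1/(n + 1)` is enough: the whole family already converges to `e`, and only
  -- the equation of `e` remains to be identified.
  obtain ⟨f, k, hk, hf, hlim⟩ := exists_weak_limit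
    (fun n : ℕ => (1 / (1 / ((n : ℝ) + 1))) • (D.toH (gε (1 / ((n : ℝ) + 1))) - D.toH g)⁻) R
    fun n => hfR _ (hpos n)
  have hseq : Tendsto (fun n : ℕ => 1 / ((n : ℝ) + 1)) atTop (𝓝[>] 0) :=
    tendsto_nhdsWithin_iff.mpr
      ⟨tendsto_one_div_add_atTop_nhds_zero_nat, Eventually.of_forall hpos⟩
  have hesol : D.SolvesLinear α f e :=
    (TimeDirichletForm.IsWeakSolution.of_tendsto
      (fun n => (hsol _ (hpos (k n))).isWeakSolution)
      ((he.comp hseq).comp hk.tendsto_atTop) hlim).solvesLinear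
  exact ⟨gε, e, fun ε hε => ⟨hgε ε hε, fun u hu => hu.unique hα hε (hgε ε hε)⟩,
    (D.toH.continuous.tendsto e).comp he, fun ε hε => hbound _ _ (hsol ε hε) (hfR ε hε),
    hesol.1, hbound f e hesol hf⟩
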